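/- There are $m$ indivisible items and $n \ge 1$ agents, with $m \ge 2n$. An allocation assigns each item to exactly one agent; $A_i$ denotes the set of items of agent $i$. Agent $i$ has a valuation $v_i$ from sets of items to the nonnegative reals. Write $v(e)=v(\{e\})$. A valuation $v$ is \emph{unit demand} if $v(S)=\max_{e\in S}v(e)$ (and $v(\emptyset)=0$), \emph{additive} if $v(S)=\sum_{e\in S}v(e)$, \emph{binary} if it is additive with all $v(e)\in\{0,1\}$, and \emph{2-valued}, for publicly known values $a>b\ge 0$ common to all agents, if it is additive with all $v(e)\in\{a,b\}$. The maximin share (MMS) of agent $i$ is $\max_P\min_{S\in P}v_i(S)$ over all partitions $P$ of the items into $n$ (possibly empty) sets, and an MMS allocation is one in which $v_i(A_i)$ is at least the MMS of agent $i$, for every $i$. In a deterministic protocol each $v_i$ is known only to agent $i$; agents answer publicly, in bits, queries about their own valuations (queries may depend on earlier answers), and the sequence of answers determines the output allocation. The deterministic communication complexity $CC$ of MMS allocations on a class of instances is the smallest worst-case total number of bits sent, over all protocols that output an MMS allocation on every instance of the class. Logarithms are to base 2, and all constants hidden in $O$, $\Omega$, $\Theta$ are absolute. (1) For all $n\ge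 1$ and $m\ge 2n$: \begin{itemize} \item for unit demand valuations, $CC = O\left(n\left(\log n+\log\log\frac mn\right)\right)$; \item for binary valuations, $CC = O(n\log m\log n)$; \item for 2-valued valuations, for every $a>b\ge 0$, $CC = O(m\log n)$; in fact some protocol attains this with each single agent sending only $O\left(\frac mn\log n\right)$ bits. \end{itemize} (2) On instances in which all agents have the same valuation (upper bounds for $n\ge 1$, lower bounds for $n\ge 2$, always with $m\ge 2n$): \begin{itemize} \item for unit demand valuations, $CC = \Theta(n+\log\log m)$; \item for binary valuations, $CC = \Omega\left(n\log\frac mn\right)$; \item for 2-valued valuations, $CC=\Theta(m)$: $CC=O(m)$ for every $a>b\ge 0$, and for all $n$ and $m$ there are $a>b\ge0$ for which $CC=\Omega(m)$. \end{itemize} -/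

import Mathlib

/-- A valuation function on sets of the `m` items `Fin m`. -/
abbrev ItemValuation (m : ℕ) : Type := Finset (Fin m) → ℝ

/-- An allocation of `m` items to `n` agents: every item goes to exactly one agent.
Bundles may be empty. The same type serves for (labelled) partitions into `n` sets. -/
abbrev Allocation (n m : ℕ) : Type := Fin m → Fin n

/-- The set of items that agent `i` receives. -/
def bundle {n m : ℕ} (A : Allocation n m) (i : Fin n) : Finset (Fin m) :=
  Finset.univ.filter fun e => A e = i

/-- Unit demand: the value of a set is the largest value of an item in it. -/
def IsUnitDemand {m : ℕ} (v : ItemValuation m) : Prop :=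
  (∀ e, 0 ≤ v {e}) ∧ v ∅ = 0 ∧
    ∀ (S : Finset (Fin m)) (hS : S.Nonempty), v S = S.sup' hS fun e => v {e}

/-- Additive: the value of a set is the sum of the values of its items. -/
def IsAdditive {m : ℕ} (v : ItemValuation m) : Prop :=
  (∀ e, 0 ≤ v {e}) ∧ ∀ S : Finset (Fin m), v S = ∑ e ∈ S, v {e}

/-- Binary additive: additive, every item has value 0 or 1. -/
def IsBinary {m : ℕ} (v : ItemValuation m) : Prop :=
  IsAdditive v ∧ ∀ e, v {e} = 0 ∨ v {e} = 1

/-- 2-valued additive with values `a` and `b`. -/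
def IsTwoValued {m : ℕ} (a b : ℝ) (v : ItemValuation m) : Prop :=
  IsAdditive v ∧ ∀ e, v {e} = a ∨ v {e} = b

/-- The maximin share: the largest, over all partitions of the items into `n` bundles, of the
least value of a bundle. For `1 ≤ n` both extrema are over nonempty finite sets. -/
noncomputable def mms (n : ℕ) {m : ℕ} (v : ItemValuation m) : ℝ :=
  ⨆ P : Allocation n m, ⨅ j : Fin n, v (bundle P j)

/-- Every agent gets at least her maximin share. -/
def IsMMSAllocation {n m : ℕ} (v : Fin n → ItemValuation m) (A : Allocation n m) : Prop :=
  ∀ i, mms n (v i) ≤ v i (bundle A i)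

/-- A deterministic protocol. At every step either an allocation is output or some agent `i`
is asked an arbitrary yes/no question about her own valuation, and the protocol continues
according to the answer. A query with a longer answer is a sequence of such questions. -/
inductive Protocol (n m : ℕ) : Type
  | output (A : Allocation n m) : Protocol n m
  | query (i : Fin n) (q : ItemValuation m → Bool) (next : Bool → Protocol n m) : Protocol n m

namespace Protocol

variable {n m : ℕ}

/-- The list of replies (sender and transmitted bit) when the valuations are `v`. -/
def transcript : Protocol n m → (Fin n → ItemValuation m) → List (Fin n × Bool)
  | output _, _ => []
  | query i q next, v => (i, q (v i)) :: transcript (next (q (v i))) v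

/-- The allocation that is output when the valuations are `v`. -/
def result : Protocol n m → (Fin n → ItemValuation m) → Allocation n m
  | output A, _ => A
  | query i q next, v => result (next (q (v i))) v

/-- Total number of bits transmitted by the agents. -/
def bits (P : Protocol n m) (v : Fin n → ItemValuation m) : ℕ :=
  (P.transcript v).length

/-- Number of bits transmitted by agent `i`. -/
def agentBits (P : Protocol n m) (v : Fin n → ItemValuation m) (i : Fin n) : ℕ :=
  ((P.transcript v).filter fun r => r.1 = i).length

/-- On every instance of the class `C`, the output is an MMS allocation. -/
def SolvesMMS (P : Protocol n m) (C : Set (Fin n → ItemValuation m)) : Prop :=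
  ∀ v ∈ C, IsMMSAllocation v (P.result v)

end Protocol

/-- `CC(MMS, C) ≤ B`: some protocol finds MMS allocations on the class `C`, sending at most `B`
bits on every instance. -/
def CCAtMost {n m : ℕ} (C : Set (Fin n → ItemValuation m)) (B : ℝ) : Prop :=
  ∃ P : Protocol n m, P.SolvesMMS C ∧ ∀ v ∈ C, (P.bits v : ℝ) ≤ B

/-- `CC(MMS, C) ≥ B`: every protocol that finds MMS allocations on the class `C` sends at least
`B` bits on some instance. -/
def CCAtLeast {n m : ℕ} (C : Set (Fin n → ItemValuation m)) (B : ℝ) : Prop :=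
  ∀ P : Protocol n m, P.SolvesMMS C → ∃ v ∈ C, B ≤ (P.bits v : ℝ)

/-- Instances in which every valuation belongs to the class `K`. -/
def instances (n : ℕ) {m : ℕ} (K : ItemValuation m → Prop) : Set (Fin n → ItemValuation m) :=
  {v | ∀ i, K (v i)}

/-- Instances in which all agents have the same valuation, from the class `K`. -/
def identicalInstances (n : ℕ) {m : ℕ} (K : ItemValuation m → Prop) : Set (Fin n → ItemValuation m) :=
  {v | ∃ u, K u ∧ ∀ i, v i = u}

/-! Lower bounds. A protocol with at most B bits has at most 2^B outputs, so it is enough that many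
allocations are needed to serve all identical instances. The hard valuations mark a set K of items,
and an allocation serves K only if its bundles meet K in forced numbers x_i. Hence it serves at most
∏ C(s_i, x_i) sets, with s_i the bundle sizes, and this is compared with the number of all
candidates K (`choose_le_sum_prod_choose`). For unit demand, |K| = n and every bundle must meet K
once. Among 2n items this serves at most 2^n of the C(2n,n) candidates. Moreover any two items must
be separated by some output, so m ≤ n^|F|. For binary valuations, |K| = nt with t about m/2n, and
each bundle loses a factor √(t+1) against 2^(s_i). For two values, a = h + 2 and b = h with h odd of
order m/n, and |K| is tuned so that the bundles of an MMS allocation exceed the target by at most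
one in total. Then sizes determine the x_i, a constant fraction of the bundles contain no large
item, and the items wasted there cost a factor 2^Ω(m) (`tight_bundles`).

Upper bounds. A 2-valued maximin share depends only on the number of large items. The agents
announce these numbers; a schedule (`exists_ordered_bundles`) then lets them pick large items in
increasing order of the numbers, at most ⌈m/n⌉ each, and other items fill the bundles up. Binary
agents halve the group and the items recursively, each naming the cut that leaves a proportional
share on the left (`exists_halving_dialogue`). A unit demand agent is content with any of her n best
items. In general the agents agree on a hash function that is injective on the n best items of each
of them, found by bisection over a field (`exists_selection_dialogue`), and then pick hash values in
turn. Identical agents need just one set coloured injectively, so one agent sends an index into a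
perfect hash family (`exists_perfect_hash_family`). -/

/-! ### Dialogues: composable protocols with public results -/

/-- A dialogue: a protocol tree whose leaves carry an arbitrary publicly known result. -/
inductive Dialogue (n m : ℕ) (α : Type) : Type
  | done (a : α) : Dialogue n m α
  | ask (i : Fin n) (q : ItemValuation m → Bool) (next : Bool → Dialogue n m α) : Dialogue n m α

namespace Dialogue

variable {n m : ℕ} {α β σ : Type}

/-- The public result of a dialogue. -/
def run : Dialogue n m α → (Fin n → ItemValuation m) → α
  | done a, _ => a
  | ask i q next, v => run (next (q (v i))) v

/-- The number of bits sent by each agent. -/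
def cost : Dialogue n m α → (Fin n → ItemValuation m) → Fin n → ℕ
  | done _, _ => 0
  | ask i q next, v => Pi.single i 1 + cost (next (q (v i))) v

/-- Continue a dialogue with one that depends on its result. -/
def bind : Dialogue n m α → (α → Dialogue n m β) → Dialogue n m β
  | done a, f => f a
  | ask i q next, f => ask i q fun b => bind (next b) f

@[simp] theorem run_done (a : α) (v : Fin n → ItemValuation m) : (done a).run v = a := rfl

@[simp] theorem cost_done (a : α) (v : Fin n → ItemValuation m) :
    (done a : Dialogue n m α).cost v = 0 := rfl

@[simp] theorem run_bind (t : Dialogue n m α) (f : α → Dialogue n m β)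
    (v : Fin n → ItemValuation m) : (t.bind f).run v = (f (t.run v)).run v := by
  induction t with
  | done a => rfl
  | ask i q next ih => exact ih _

@[simp] theorem cost_bind (t : Dialogue n m α) (f : α → Dialogue n m β)
    (v : Fin n → ItemValuation m) :
    (t.bind f).cost v = t.cost v + (f (t.run v)).cost v := by
  induction t with
  | done a => simp [bind, run]
  | ask i q next ih => simp only [bind, cost, run, ih, add_assoc]

/-- A dialogue that ends with an allocation is a protocol. -/
def toProtocol : Dialogue n m (Allocation n m) → Protocol n m
  | done A => .output A
  | ask i q next => .query i q fun b => toProtocol (next b)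

theorem result_toProtocol (t : Dialogue n m (Allocation n m)) (v : Fin n → ItemValuation m) :
    t.toProtocol.result v = t.run v := by
  induction t with
  | done a => rfl
  | ask i q next ih => exact ih _

theorem agentBits_toProtocol (t : Dialogue n m (Allocation n m)) (v : Fin n → ItemValuation m)
    (i : Fin n) : t.toProtocol.agentBits v i = t.cost v i := by
  induction t with
  | done a => rfl
  | ask j q next ih =>
    have := ih (q (v j))
    simp only [Protocol.agentBits] at this
    simp only [Protocol.agentBits, toProtocol, Protocol.transcript, List.filter_cons, cost,
      Pi.add_apply, ← this]
    by_cases h : j = i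
    · subst h; simp [add_comm]
    · simp [h, Ne.symm h]

theorem bits_toProtocol (t : Dialogue n m (Allocation n m)) (v : Fin n → ItemValuation m) :
    t.toProtocol.bits v = ∑ i, t.cost v i := by
  induction t with
  | done a => simp [toProtocol, Protocol.bits, Protocol.transcript]
  | ask j q next ih =>
    have := ih (q (v j))
    simp only [Protocol.bits] at this
    simp [Protocol.bits, toProtocol, Protocol.transcript, cost, Finset.sum_add_distrib, this,
      add_comm]

/-- Run through a list of agents, each step updating a public state. -/
def foldl (step : σ → Fin n → Dialogue n m σ) : σ → List (Fin n) → Dialogue n m σ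
  | s, [] => done s
  | s, i :: l => (step s i).bind fun s' => foldl step s' l

theorem run_foldl (step : σ → Fin n → Dialogue n m σ) (s : σ) (l : List (Fin n))
    (v : Fin n → ItemValuation m) :
    (foldl step s l).run v = l.foldl (fun s i => (step s i).run v) s := by
  induction l generalizing s with
  | nil => rfl
  | cons i l ih => simp [foldl, ih]

theorem cost_foldl (step : σ → Fin n → Dialogue n m σ) (s : σ) (l : List (Fin n))
    (v : Fin n → ItemValuation m) (c : Fin n → Fin n → ℕ)
    (hc : ∀ s i, (step s i).cost v = c i) :
    (foldl step s l).cost v = (l.map c).sum := by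
  induction l generalizing s with
  | nil => rfl
  | cons i l ih => simp [foldl, ih, hc]

/-- Agent `i` sends the last `L` binary digits of a number. -/
def sendDigits (i : Fin n) : ℕ → (ItemValuation m → ℕ) → Dialogue n m ℕ
  | 0, _ => done 0
  | L + 1, f => ask i (fun u => (f u).bodd) fun b =>
      (sendDigits i L fun u => (f u).div2).bind fun a => done (Nat.bit b a)

theorem run_sendDigits (i : Fin n) (L : ℕ) (f : ItemValuation m → ℕ)
    (v : Fin n → ItemValuation m) (h : f (v i) < 2 ^ L) :
    (sendDigits i L f).run v = f (v i) := by
  induction L generalizing f with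
  | zero => simp at h; simp [sendDigits, h]
  | succ L ih =>
    have h2 : (f (v i)).div2 < 2 ^ L := by
      rw [Nat.div2_val]; rw [pow_succ] at h; omega
    simp only [sendDigits, run, run_bind]
    rw [ih (fun u => (f u).div2) h2]
    exact Nat.bit_bodd_div2 _

theorem cost_sendDigits (i : Fin n) (L : ℕ) (f : ItemValuation m → ℕ)
    (v : Fin n → ItemValuation m) : (sendDigits i L f).cost v = Pi.single i L := by
  induction L generalizing f with
  | zero => simp [sendDigits]
  | succ L ih => simp [sendDigits, cost, ih, ← Pi.single_add, add_comm]

/-- A message from a finite type with at most `2 ^ L` elements costs `L` bits. -/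
theorem exists_send [Finite α] (i : Fin n) (L : ℕ) (hL : Nat.card α ≤ 2 ^ L)
    (f : ItemValuation m → α) :
    ∃ t : Dialogue n m α, ∀ v, t.run v = f (v i) ∧ t.cost v = Pi.single i L := by
  classical
  let e := Finite.equivFin α
  -- `f fun _ => 0` is merely some element of `α`, used for numbers that are never sent.
  let back : ℕ → α := fun a => if h : a < Nat.card α then e.symm ⟨a, h⟩ else f fun _ => 0
  refine ⟨(sendDigits i L fun u => (e (f u)).val).bind fun a => done (back a), fun v => ?_⟩
  have h : (e (f (v i))).val < 2 ^ L := (e (f (v i))).isLt.trans_le hL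
  constructor
  · rw [run_bind, run_sendDigits i L (fun u => (e (f u)).val) v h]
    simp [back]
  · simp [cost_sendDigits]

/-- Agent `i` sends a number in unary, truncated at `K`. -/
def sendUnary (i : Fin n) : ℕ → (ItemValuation m → ℕ) → Dialogue n m ℕ
  | 0, _ => done 0
  | K + 1, f => ask i (fun u => decide (f u = 0)) fun b =>
      if b then done 0 else (sendUnary i K fun u => f u - 1).bind fun a => done (a + 1)

theorem run_sendUnary (i : Fin n) (K : ℕ) (f : ItemValuation m → ℕ)
    (v : Fin n → ItemValuation m) (h : f (v i) ≤ K) :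
    (sendUnary i K f).run v = f (v i) := by
  induction K generalizing f with
  | zero => simp at h; simp [sendUnary, h]
  | succ K ih =>
    by_cases h0 : f (v i) = 0
    · simp [sendUnary, run, h0]
    · simp only [sendUnary, run, h0, decide_false, Bool.false_eq_true, if_false, run_bind]
      rw [ih _ (by omega)]
      omega

theorem cost_sendUnary (i : Fin n) (K : ℕ) (f : ItemValuation m → ℕ)
    (v : Fin n → ItemValuation m) :
    (sendUnary i K f).cost v ≤ Pi.single i (f (v i) + 1) := by
  induction K generalizing f with
  | zero => simp [sendUnary]
  | succ K ih =>
    by_cases h0 : f (v i) = 0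
    · simp [sendUnary, cost, h0]
    · simp only [sendUnary, cost, h0, decide_false, Bool.false_eq_true, if_false, cost_bind]
      refine (add_le_add_right (ih _) _).trans ?_
      rw [← Pi.single_add, show 1 + (f (v i) - 1 + 1) = f (v i) + 1 by omega]

/-- The agents of a list carry out one dialogue each; all results are public afterwards. -/
theorem exists_gather [Inhabited α] (d : Fin n → Dialogue n m α) (G : Finset (Fin n)) :
    ∃ t : Dialogue n m (Fin n → α), ∀ v, (∀ i ∈ G, t.run v i = (d i).run v) ∧
      t.cost v = ∑ i ∈ G, (d i).cost v := by
  classical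
  induction G using Finset.induction_on with
  | empty => exact ⟨done fun _ => default, fun v => by simp⟩
  | insert i G hi ih =>
    obtain ⟨t, ht⟩ := ih
    refine ⟨t.bind fun g => (d i).bind fun a => done (Function.update g i a), fun v => ?_⟩
    obtain ⟨h1, h2⟩ := ht v
    constructor
    · intro j hj
      rcases Finset.mem_insert.1 hj with rfl | hj
      · simp
      · have : j ≠ i := fun h => hi (h ▸ hj)
        simp [Function.update_of_ne this, h1 j hj]
    · simp [Finset.sum_insert hi, h2, add_comm]

end Dialogue

/-! ### From dialogues and output sets to communication complexity -/

/-- An upper bound on the communication complexity from a dialogue. -/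
theorem CCAtMost.of_dialogue {n m : ℕ} {C : Set (Fin n → ItemValuation m)} {B : ℝ}
    (t : Dialogue n m (Allocation n m)) (h : ∀ v ∈ C, IsMMSAllocation v (t.run v))
    (hB : ∀ v ∈ C, ((∑ i, t.cost v i : ℕ) : ℝ) ≤ B) : CCAtMost C B :=
  ⟨t.toProtocol, fun v hv => by rw [t.result_toProtocol]; exact h v hv,
    fun v hv => by rw [t.bits_toProtocol]; exact hB v hv⟩

/-- The outputs of a protocol with at most `k` bits form a set of at most `2 ^ k` allocations. -/
theorem Protocol.exists_outputs {n m : ℕ} (P : Protocol n m) (C : Set (Fin n → ItemValuation m))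
    (k : ℕ) (h : ∀ v ∈ C, P.bits v ≤ k) :
    ∃ F : Finset (Allocation n m), F.card ≤ 2 ^ k ∧ ∀ v ∈ C, P.result v ∈ F := by
  classical
  induction P generalizing C k with
  | output A => exact ⟨{A}, by simp [Nat.one_le_two_pow], by simp [Protocol.result]⟩
  | query i q next ih =>
    rcases C.eq_empty_or_nonempty with rfl | ⟨v₀, hv₀⟩
    · exact ⟨∅, by simp, by simp⟩
    · obtain ⟨k, rfl⟩ : ∃ k', k = k' + 1 := by
        have := h v₀ hv₀
        simp only [Protocol.bits, Protocol.transcript, List.length_cons] at this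
        exact ⟨k - 1, by omega⟩
      have key : ∀ b, ∃ F : Finset (Allocation n m), F.card ≤ 2 ^ k ∧
          ∀ v ∈ {v ∈ C | q (v i) = b}, (next b).result v ∈ F := by
        refine fun b => ih b _ k ?_
        rintro v ⟨hv, rfl⟩
        have := h v hv
        simp only [Protocol.bits, Protocol.transcript, List.length_cons] at this
        simpa [Protocol.bits] using this
      choose F hF hF' using key
      refine ⟨F true ∪ F false, ?_, fun v hv => ?_⟩
      · have := Finset.card_union_le (F true) (F false)
        have := hF true
        have := hF false
        rw [pow_succ]; omega
      · have := hF' (q (v i)) v ⟨hv, rfl⟩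
        simp only [Protocol.result, Finset.mem_union]
        cases hq : q (v i) <;> rw [hq] at this <;> simp [this]

/-- A lower bound on the communication complexity from a lower bound on the number of
allocations that are needed to serve all instances. -/
theorem CCAtLeast.of_outputs {n m : ℕ} {C : Set (Fin n → ItemValuation m)} {X : ℝ}
    (hC : C.Nonempty)
    (h : ∀ F : Finset (Allocation n m), (∀ v ∈ C, ∃ A ∈ F, IsMMSAllocation v A) →
      X ≤ Real.logb 2 F.card) : CCAtLeast C X := by
  intro P hP
  by_contra hcon
  push Not at hcon
  obtain ⟨v₀, hv₀⟩ := hC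
  have hX : 0 < ⌈X⌉₊ := Nat.ceil_pos.2 ((Nat.cast_nonneg _).trans_lt (hcon v₀ hv₀))
  -- Bit counts are integers, so fewer than X bits means at most ⌈X⌉ - 1.
  obtain ⟨F, hF, hF'⟩ := P.exists_outputs C (⌈X⌉₊ - 1) fun v hv => by
    have := Nat.lt_ceil.2 (hcon v hv)
    omega
  have h1 := h F fun v hv => ⟨_, hF' v hv, hP v hv⟩
  have hpos : 0 < F.card := Finset.card_pos.2 ⟨_, hF' v₀ hv₀⟩
  have h2 : Real.logb 2 F.card ≤ ((⌈X⌉₊ - 1 : ℕ) : ℝ) := by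
    rw [Real.logb_le_iff_le_rpow (by norm_num) (by exact_mod_cast hpos), Real.rpow_natCast]
    exact_mod_cast hF
  have h3 : ((⌈X⌉₊ - 1 : ℕ) : ℝ) < X := Nat.lt_ceil.1 (by omega)
  linarith

/-! ### Bundles, maximin shares, dealing, and two-valued valuations -/

section Basics

variable {n m : ℕ}

@[simp] theorem mem_bundle {A : Allocation n m} {i : Fin n} {e : Fin m} :
    e ∈ bundle A i ↔ A e = i := by simp [bundle]

theorem sum_card_inter_bundle (A : Allocation n m) (K : Finset (Fin m)) :
    ∑ i, (K ∩ bundle A i).card = K.card := by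
  rw [Finset.card_eq_sum_card_fiberwise (f := A) (t := Finset.univ) (by simp)]
  refine Finset.sum_congr rfl fun i _ => congrArg _ ?_
  ext e; simp

theorem sum_card_bundle (A : Allocation n m) : ∑ i, (bundle A i).card = m := by
  simpa using sum_card_inter_bundle A Finset.univ

theorem mms_le (hn : 1 ≤ n) {v : ItemValuation m} {x : ℝ}
    (h : ∀ P : Allocation n m, ∃ j, v (bundle P j) ≤ x) : mms n v ≤ x := by
  have : Nonempty (Fin n) := ⟨⟨0, hn⟩⟩
  refine ciSup_le fun P => ?_
  obtain ⟨j, hj⟩ := h P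
  exact (ciInf_le (Set.finite_range _).bddBelow j).trans hj

theorem le_mms (hn : 1 ≤ n) {v : ItemValuation m} {x : ℝ} (P : Allocation n m)
    (h : ∀ j, x ≤ v (bundle P j)) : x ≤ mms n v := by
  have : Nonempty (Fin n) := ⟨⟨0, hn⟩⟩
  exact (le_ciInf h).trans
    (le_ciSup (f := fun P : Allocation n m => ⨅ j, v (bundle P j))
      (Set.finite_range _).bddAbove P)

theorem exists_mms_partition (hn : 1 ≤ n) (v : ItemValuation m) :
    ∃ P : Allocation n m, ∀ j, mms n v ≤ v (bundle P j) := by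
  have : Nonempty (Fin n) := ⟨⟨0, hn⟩⟩
  obtain ⟨P, hP⟩ := exists_eq_ciSup_of_finite (f := fun P : Allocation n m => ⨅ j, v (bundle P j))
  refine ⟨P, fun j => ?_⟩
  rw [mms, ← hP]
  exact ciInf_le (Set.finite_range _).bddBelow j

theorem isMMSAllocation_one (v : Fin 1 → ItemValuation m) (A : Allocation 1 m) :
    IsMMSAllocation v A := by
  intro i
  refine mms_le le_rfl fun P => ⟨i, ?_⟩
  rw [Subsingleton.elim P A]

/-- With one agent no communication is needed. -/
theorem CCAtMost.one_agent (C : Set (Fin 1 → ItemValuation m)) {B : ℝ} (hB : 0 ≤ B) :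
    CCAtMost C B :=
  CCAtMost.of_dialogue (.done fun _ => 0) (fun v _ => isMMSAllocation_one v _)
    (fun v _ => by simpa using hB)

/-- Items can be dealt out so that every agent gets a prescribed number of the items in `S`. -/
theorem exists_deal {ι : Type*} [DecidableEq ι] (hn : 1 ≤ n) (S : Finset ι) (x : Fin n → ℕ)
    (h : ∑ i, x i ≤ S.card) : ∃ f : ι → Fin n, ∀ i, x i ≤ {e ∈ S | f e = i}.card := by
  classical
  have key : ∀ G : Finset (Fin n), ∀ S : Finset ι, ∑ i ∈ G, x i ≤ S.card →
      ∃ f : ι → Fin n, ∀ i ∈ G, x i ≤ {e ∈ S | f e = i}.card := by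
    intro G
    induction G using Finset.induction_on with
    | empty => exact fun S _ => ⟨fun _ => ⟨0, hn⟩, by simp⟩
    | insert i G hi ih =>
      intro S hS
      rw [Finset.sum_insert hi] at hS
      obtain ⟨T, hT, hTc⟩ := Finset.exists_subset_card_eq (s := S) (n := x i) (by omega)
      obtain ⟨f, hf⟩ := ih (S \ T) (by rw [Finset.card_sdiff_of_subset hT]; omega)
      refine ⟨fun e => if e ∈ T then i else f e, fun j hj => ?_⟩
      rcases Finset.mem_insert.1 hj with rfl | hj
      · rw [← hTc]
        exact Finset.card_le_card fun e he => by simp [hT he, he]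
      · refine (hf j hj).trans (Finset.card_le_card fun e he => ?_)
        simp only [Finset.mem_filter, Finset.mem_sdiff] at he ⊢
        simp [he]
  obtain ⟨f, hf⟩ := key Finset.univ S h
  exact ⟨f, fun i => hf i (Finset.mem_univ i)⟩

/-- A finite set has a subset of given size whose elements have the largest keys. -/
theorem exists_top_subset {ι κ : Type*} [DecidableEq ι] [LinearOrder κ] (S : Finset ι)
    (f : ι → κ) {k : ℕ} (hk : k ≤ S.card) :
    ∃ T ⊆ S, T.card = k ∧ ∀ e ∈ T, ∀ e' ∈ S \ T, f e' ≤ f e := by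
  induction k with
  | zero => exact ⟨∅, by simp⟩
  | succ k ih =>
    obtain ⟨T, hT, hTc, h⟩ := ih (by omega)
    have hne : (S \ T).Nonempty := by
      rw [← Finset.card_pos, Finset.card_sdiff_of_subset hT]; omega
    obtain ⟨x, hx, hmax⟩ := Finset.exists_max_image (S \ T) f hne
    have hxS := Finset.mem_sdiff.1 hx
    refine ⟨insert x T, Finset.insert_subset hxS.1 hT, ?_, fun e he e' he' => ?_⟩
    · rw [Finset.card_insert_of_notMem hxS.2, hTc]
    · have he'' : e' ∈ S \ T := by
        simp only [Finset.mem_sdiff, Finset.mem_insert, not_or] at he' ⊢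
        exact ⟨he'.1, he'.2.2⟩
      rcases Finset.mem_insert.1 he with rfl | he
      · exact hmax e' he''
      · exact h e he e' he''

/-- Few sets have prescribed intersection sizes with disjoint blocks that cover them. -/
theorem card_filter_inter_bundle_le (A : Allocation n m) (U : Finset (Fin m)) (x : Fin n → ℕ) :
    {K ∈ U.powerset | ∀ i, (K ∩ bundle A i).card = x i}.card
      ≤ ∏ i, (U ∩ bundle A i).card.choose (x i) := by
  classical
  have : ∏ i, (U ∩ bundle A i).card.choose (x i)
      = (Fintype.piFinset fun i => Finset.powersetCard (x i) (U ∩ bundle A i)).card := by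
    simp [Fintype.card_piFinset]
  rw [this]
  refine Finset.card_le_card_of_injOn (fun K i => K ∩ bundle A i) ?_ ?_
  · intro K hK
    simp only [Finset.coe_filter, Finset.mem_powerset, Set.mem_ofPred_eq] at hK
    simp only [Finset.mem_coe, Fintype.mem_piFinset, Finset.mem_powersetCard]
    exact fun i => ⟨Finset.inter_subset_inter_right hK.1, hK.2 i⟩
  · intro K _ K' _ h
    ext e
    have := Finset.ext_iff.1 (congrFun h (A e)) e
    simpa using this

/-- The additive valuation with value `a` on `K` and `b` elsewhere. -/
def twoValue (a b : ℝ) (K : Finset (Fin m)) : ItemValuation m :=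
  fun S => ∑ e ∈ S, if e ∈ K then a else b

theorem twoValue_singleton (a b : ℝ) (K : Finset (Fin m)) (e : Fin m) :
    twoValue a b K {e} = if e ∈ K then a else b := by simp [twoValue]

theorem isTwoValued_twoValue {a b : ℝ} (hb : 0 ≤ b) (hab : b < a) (K : Finset (Fin m)) :
    IsTwoValued a b (twoValue a b K) := by
  refine ⟨⟨fun e => ?_, fun S => ?_⟩, fun e => ?_⟩
  · rw [twoValue_singleton]; split_ifs <;> linarith
  · simp [twoValue]
  · rw [twoValue_singleton]; split_ifs <;> simp

/-- The items of value `a`. -/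
noncomputable def bigItems (a : ℝ) (v : ItemValuation m) : Finset (Fin m) :=
  {e | v {e} = a}

theorem IsTwoValued.eq_twoValue {a b : ℝ} {v : ItemValuation m} (h : IsTwoValued a b v) :
    v = twoValue a b (bigItems a v) := by
  funext S
  rw [h.1.2, twoValue]
  refine Finset.sum_congr rfl fun e _ => ?_
  rcases h.2 e with he | he
  · simp [bigItems, he]
  · by_cases hba : b = a
    · simp [he, hba]
    · simp [bigItems, he, hba]

theorem twoValue_apply (a b : ℝ) (K S : Finset (Fin m)) :
    twoValue a b K S = a * (K ∩ S).card + b * (S \ K).card := by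
  rw [twoValue, Finset.sum_ite]
  simp only [Finset.sum_const, nsmul_eq_mul, Finset.filter_mem_eq_inter,
    Finset.filter_notMem_eq_sdiff]
  rw [Finset.inter_comm]; ring

theorem twoValue_eq (a b : ℝ) (K S : Finset (Fin m)) :
    twoValue a b K S = b * S.card + (a - b) * (K ∩ S).card := by
  rw [twoValue_apply, ← Finset.card_sdiff_add_card_inter S K, Finset.inter_comm S K]
  push_cast; ring

theorem isBinary_iff {v : ItemValuation m} : IsBinary v ↔ IsTwoValued 1 0 v := by
  simp only [IsBinary, IsTwoValued, or_comm]

end Basics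

theorem logb_two_le_two_mul {x : ℝ} (hx : 0 < x) : Real.logb 2 x ≤ 2 * x := by
  have e1 := Real.log_le_sub_one_of_pos hx
  have e2 : (1 / 2 : ℝ) < Real.log 2 := by linarith [Real.log_two_gt_d9]
  rw [Real.logb, div_le_iff₀ (by linarith)]
  nlinarith

/-! ### Lower bounds for identical unit demand and binary valuations -/

section LowerBounds

variable {n m : ℕ}

/-- Allocations that split every `k`-subset of `U` in sizes determined by the allocation. -/
theorem choose_le_sum_prod_choose (F : Finset (Allocation n m)) (U : Finset (Fin m)) (k : ℕ)
    (x : Allocation n m → Fin n → ℕ)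
    (h : ∀ K ⊆ U, K.card = k → ∃ A ∈ F, ∀ i, (K ∩ bundle A i).card = x A i) :
    U.card.choose k ≤ ∑ A ∈ F, ∏ i, (U ∩ bundle A i).card.choose (x A i) := by
  classical
  rw [← Finset.card_powersetCard]
  calc (Finset.powersetCard k U).card
      ≤ (F.biUnion fun A => {K ∈ U.powerset | ∀ i, (K ∩ bundle A i).card = x A i}).card := by
        refine Finset.card_le_card fun K hK => ?_
        rw [Finset.mem_powersetCard] at hK
        obtain ⟨A, hA, hA'⟩ := h K hK.1 hK.2
        simp only [Finset.mem_biUnion, Finset.mem_filter, Finset.mem_powerset]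
        exact ⟨A, hA, hK.1, hA'⟩
    _ ≤ _ := Finset.card_biUnion_le.trans
        (Finset.sum_le_sum fun A _ => card_filter_inter_bundle_le A U (x A))

/-- The n intersections add up to n * t, so none has room for more than t. -/
theorem card_inter_bundle_eq_of_le {A : Allocation n m} {K : Finset (Fin m)} {t : ℕ}
    (hK : K.card = n * t) (h : ∀ i, t ≤ (K ∩ bundle A i).card) (i : Fin n) :
    (K ∩ bundle A i).card = t := by
  have h1 : ∑ _i : Fin n, t = ∑ i, (K ∩ bundle A i).card := by
    rw [sum_card_inter_bundle, hK]; simp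
  exact ((Finset.sum_eq_sum_iff_of_le fun i _ => h i).1 h1 i (Finset.mem_univ i)).symm

/-- Consecutive central binomial coefficients have ratio 2(2n+1)/(n+1) ≥ 3. Any growth rate above 2
beats the 2^n sets that one allocation can separate. -/
theorem three_pow_mul_le_centralBinom (n : ℕ) (hn : 1 ≤ n) :
    3 ^ (n - 1) * 2 ^ n ≤ 2 ^ (n - 1) * n.centralBinom := by
  induction n, hn using Nat.le_induction with
  | base => simp [Nat.centralBinom]
  | succ n hn ih =>
    obtain ⟨n, rfl⟩ : ∃ k, n = k + 1 := ⟨n - 1, by omega⟩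
    simp only [Nat.add_sub_cancel] at ih ⊢
    have h := Nat.succ_mul_centralBinom_succ (n + 1)
    refine Nat.le_of_mul_le_mul_left (c := n + 1 + 1) ?_ (by omega)
    calc (n + 1 + 1) * (3 ^ (n + 1) * 2 ^ (n + 1 + 1))
        = (3 * (n + 2) * 2) * (3 ^ n * 2 ^ (n + 1)) := by ring
      _ ≤ (3 * (n + 2) * 2) * (2 ^ n * (n + 1).centralBinom) := by gcongr
      _ ≤ (2 * (2 * (n + 1) + 1) * 2) * (2 ^ n * (n + 1).centralBinom) :=
          Nat.mul_le_mul_right _ (by omega)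
      _ = 2 ^ (n + 1) * (2 * (2 * (n + 1) + 1) * (n + 1).centralBinom) := by ring
      _ = _ := by rw [← h]; ring

/-- The estimate C(2n,n) ≥ 4^n / (2√n), squared to stay in ℕ; the induction step is 4n(n+1) ≤
(2n+1)^2. -/
theorem sixteen_pow_le_centralBinom_sq (n : ℕ) (hn : 1 ≤ n) :
    16 ^ n ≤ 4 * n * n.centralBinom ^ 2 := by
  induction n, hn using Nat.le_induction with
  | base => simp [Nat.centralBinom]
  | succ n hn ih =>
    have h := Nat.succ_mul_centralBinom_succ n
    refine Nat.le_of_mul_le_mul_left (c := n * (n + 1)) ?_ (by positivity)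
    calc n * (n + 1) * 16 ^ (n + 1) = (n * (n + 1) * 16) * 16 ^ n := by ring
      _ ≤ (n * (n + 1) * 16) * (4 * n * n.centralBinom ^ 2) := by gcongr
      _ = 16 * n * (4 * n * (n + 1)) * n.centralBinom ^ 2 := by ring
      _ ≤ 16 * n * ((2 * n + 1) ^ 2) * n.centralBinom ^ 2 := by gcongr; nlinarith
      _ = 4 * n * (2 * (2 * n + 1) * n.centralBinom) ^ 2 := by ring
      _ = n * (n + 1) * (4 * (n + 1) * (n + 1).centralBinom ^ 2) := by rw [← h]; ring

/-- The companion C(2n,n) ≤ 4^n / √(2n+1), from (2n+1)(2n+3) ≤ 4(n+1)^2. -/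
theorem centralBinom_sq_mul_le (n : ℕ) : n.centralBinom ^ 2 * (2 * n + 1) ≤ 16 ^ n := by
  induction n with
  | zero => simp
  | succ n ih =>
    have h := Nat.succ_mul_centralBinom_succ n
    refine Nat.le_of_mul_le_mul_left (c := (n + 1) ^ 2) ?_ (by positivity)
    calc (n + 1) ^ 2 * ((n + 1).centralBinom ^ 2 * (2 * (n + 1) + 1))
        = ((n + 1) * (n + 1).centralBinom) ^ 2 * (2 * n + 3) := by ring
      _ = (4 * ((2 * n + 1) * (2 * n + 3))) * (n.centralBinom ^ 2 * (2 * n + 1)) := by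
          rw [h]; ring
      _ ≤ (16 * (n + 1) ^ 2) * 16 ^ n := by gcongr ?_ * ?_; nlinarith
      _ = (n + 1) ^ 2 * 16 ^ (n + 1) := by ring

/-- When t ≤ s, it suffices to bound the middle coefficient by 2^s / √(s+1). For odd s, twice the
middle coefficient is the next central one. The factor √(t+1), gained once per bundle, is the source
of the logarithm in the binary lower bound. -/
theorem choose_sq_mul_le (s t : ℕ) : s.choose t ^ 2 * (t + 1) ≤ 4 ^ s := by
  rcases lt_or_ge s t with h | h
  · simp [Nat.choose_eq_zero_of_lt h]
  suffices h' : s.choose (s / 2) ^ 2 * (s + 1) ≤ 4 ^ s by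
    refine le_trans ?_ h'
    gcongr
    exact Nat.choose_le_middle t s
  rcases Nat.even_or_odd' s with ⟨k, rfl | rfl⟩
  · have := centralBinom_sq_mul_le k
    rw [Nat.mul_div_cancel_left k (by norm_num), pow_mul]
    simpa [Nat.centralBinom] using this
  · have h1 := centralBinom_sq_mul_le (k + 1)
    have h2 : (k + 1).centralBinom = 2 * (2 * k + 1).choose k := by
      rw [Nat.centralBinom, show 2 * (k + 1) = (2 * k + 1) + 1 by ring, Nat.choose_succ_succ,
        two_mul ((2 * k + 1).choose k)]
      congr 1
      exact Nat.choose_symm_half k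
    have h3 : (2 * k + 1) / 2 = k := by omega
    rw [h3]
    rw [h2] at h1
    have h4 : 4 ^ (2 * k + 1) = 4 * 16 ^ k := by rw [pow_succ, pow_mul]; ring
    rw [h4]
    have h5 : (16 : ℕ) ^ (k + 1) = 16 * 16 ^ k := by ring
    rw [h5] at h1
    nlinarith [Nat.zero_le (((2 * k + 1).choose k) ^ 2)]

/-- The number of allocations of which one splits every `n * t`-subset evenly. -/
theorem card_outputs_even_split (F : Finset (Allocation n m)) {t : ℕ} (ht : 1 ≤ t) (hn : 1 ≤ n)
    (hm : 2 * n * t ≤ m)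
    (h : ∀ K : Finset (Fin m), K.card = n * t → ∃ A ∈ F, ∀ i, t ≤ (K ∩ bundle A i).card) :
    (t + 1) ^ n ≤ 4 * (n * t) * F.card ^ 2 := by
  obtain ⟨U, -, hU⟩ := Finset.exists_subset_card_eq (s := (Finset.univ : Finset (Fin m)))
    (n := 2 * n * t) (by simpa using hm)
  have h1 := choose_le_sum_prod_choose F U (n * t) (fun _ _ => t) fun K _ hK => by
    obtain ⟨A, hA, hA'⟩ := h K hK
    exact ⟨A, hA, card_inter_bundle_eq_of_le hK hA'⟩
  set N := n * t with hN
  have hUN : U.card = 2 * N := by rw [hU, hN]; ring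
  -- The parts of U in the bundles have 2N elements in total, so the powers of 4 multiply to 16^N
  -- whatever the sizes are.
  have h2 : ∀ A ∈ F, (∏ i, (U ∩ bundle A i).card.choose t) ^ 2 * (t + 1) ^ n ≤ 16 ^ N := by
    intro A _
    calc (∏ i, (U ∩ bundle A i).card.choose t) ^ 2 * (t + 1) ^ n
        = ∏ i : Fin n, ((U ∩ bundle A i).card.choose t ^ 2 * (t + 1)) := by
          rw [Finset.prod_mul_distrib, Finset.prod_pow]; simp
      _ ≤ ∏ i : Fin n, 4 ^ (U ∩ bundle A i).card :=
          Finset.prod_le_prod' fun i _ => choose_sq_mul_le _ _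
      _ = 16 ^ N := by
          rw [Finset.prod_pow_eq_pow_sum, sum_card_inter_bundle, hUN, pow_mul]
          norm_num
  rcases F.eq_empty_or_nonempty with rfl | hF
  · rw [hUN] at h1
    have := Nat.choose_pos (show N ≤ 2 * N by omega)
    simp at h1; omega
  obtain ⟨A, hA, hmax⟩ := Finset.exists_max_image F
    (fun A => ∏ i, (U ∩ bundle A i).card.choose t) hF
  have h3 : N.centralBinom ≤ F.card * ∏ i, (U ∩ bundle A i).card.choose t := by
    rw [Nat.centralBinom, ← hUN]
    refine h1.trans ?_
    rw [← smul_eq_mul]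
    exact Finset.sum_le_card_nsmul _ _ _ hmax
  have hN1 : 1 ≤ N := Nat.mul_pos hn ht
  have h4 := sixteen_pow_le_centralBinom_sq N hN1
  have h5 := h2 A hA
  set Q := ∏ i, (U ∩ bundle A i).card.choose t
  refine Nat.le_of_mul_le_mul_left (c := 16 ^ N) ?_ (by positivity)
  calc 16 ^ N * (t + 1) ^ n ≤ 4 * N * (F.card * Q) ^ 2 * (t + 1) ^ n := by
        gcongr; exact h4.trans (by gcongr)
    _ = 4 * N * F.card ^ 2 * (Q ^ 2 * (t + 1) ^ n) := by ring
    _ ≤ 4 * N * F.card ^ 2 * 16 ^ N := by gcongr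
    _ = _ := by ring

/-- The number of allocations of which one separates the elements of every `n`-subset. -/
theorem card_outputs_rainbow (F : Finset (Allocation n m)) (hn : 2 ≤ n) (hm : 2 * n ≤ m)
    (h : ∀ K : Finset (Fin m), K.card = n → ∃ A ∈ F, ∀ i, 1 ≤ (K ∩ bundle A i).card) :
    (n : ℝ) ≤ 4 * Real.logb 2 F.card := by
  obtain ⟨U, -, hU⟩ := Finset.exists_subset_card_eq (s := (Finset.univ : Finset (Fin m)))
    (n := 2 * n) (by simpa using hm)
  have h1 := choose_le_sum_prod_choose F U n (fun _ _ => 1) fun K _ hK => by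
    obtain ⟨A, hA, hA'⟩ := h K hK
    exact ⟨A, hA, card_inter_bundle_eq_of_le (by simpa using hK) hA'⟩
  -- A product of n sizes with sum 2n is at most 2^n, because 2s ≤ 2^s for every natural s, with
  -- equality at s = 1 and s = 2.
  have h2 : ∀ A ∈ F, ∏ i, (U ∩ bundle A i).card.choose 1 ≤ 2 ^ n := by
    intro A _
    refine Nat.le_of_mul_le_mul_left (c := 2 ^ n) ?_ (by positivity)
    calc 2 ^ n * ∏ i, (U ∩ bundle A i).card.choose 1
        = ∏ i, (2 * (U ∩ bundle A i).card) := by simp [Finset.prod_mul_distrib]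
      _ ≤ ∏ i, 2 ^ (U ∩ bundle A i).card := by
          refine Finset.prod_le_prod' fun i _ => ?_
          generalize (U ∩ bundle A i).card = s
          rcases s with _ | s
          · simp
          · rw [pow_succ]
            have := Nat.lt_two_pow_self (n := s)
            omega
      _ = 2 ^ n * 2 ^ n := by
          rw [Finset.prod_pow_eq_pow_sum, sum_card_inter_bundle, hU, two_mul, pow_add]
  have h3 : n.centralBinom ≤ F.card * 2 ^ n := by
    rw [Nat.centralBinom, ← hU]
    refine h1.trans ?_
    rw [← smul_eq_mul]
    exact Finset.sum_le_card_nsmul _ _ _ h2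
  have h4 := three_pow_mul_le_centralBinom n (by omega)
  have h5 : 3 ^ (n - 1) ≤ 2 ^ (n - 1) * F.card := by
    refine Nat.le_of_mul_le_mul_right (c := 2 ^ n) (h4.trans ?_) (by positivity)
    rw [mul_assoc]; gcongr
  -- Squaring |F| ≥ (3/2)^(n-1) and using 9/4 ≥ 2.
  have h6 : 2 ^ (n - 1) ≤ F.card ^ 2 := by
    refine Nat.le_of_mul_le_mul_left (c := 4 ^ (n - 1)) ?_ (by positivity)
    calc 4 ^ (n - 1) * 2 ^ (n - 1) = 8 ^ (n - 1) := by rw [← mul_pow]; norm_num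
      _ ≤ 9 ^ (n - 1) := by gcongr; norm_num
      _ = (3 ^ (n - 1)) ^ 2 := by rw [← pow_mul, mul_comm, pow_mul]; norm_num
      _ ≤ (2 ^ (n - 1) * F.card) ^ 2 := by gcongr
      _ = _ := by rw [mul_pow, ← pow_mul, mul_comm (n - 1), pow_mul]; norm_num
  have hF : 0 < F.card := by
    rcases Nat.eq_zero_or_pos F.card with h0 | h0
    · rw [h0] at h6; simp at h6
    · exact h0
  have h7 : ((n - 1 : ℕ) : ℝ) ≤ Real.logb 2 ((F.card : ℝ) ^ 2) := by
    rw [Real.le_logb_iff_rpow_le (by norm_num) (by positivity), Real.rpow_natCast]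
    exact_mod_cast h6
  rw [Real.logb_pow] at h7
  rw [Nat.cast_sub (by omega)] at h7
  have : (2 : ℝ) ≤ n := by exact_mod_cast hn
  push_cast at h7
  linarith

/-- The unit demand valuation in which the items of `K` have value one, all others zero. -/
noncomputable def hitValue (K : Finset (Fin m)) : ItemValuation m :=
  fun S => if (K ∩ S).Nonempty then 1 else 0

theorem isUnitDemand_hitValue (K : Finset (Fin m)) : IsUnitDemand (hitValue K) := by
  refine ⟨fun e => ?_, by simp [hitValue], fun S hS => le_antisymm ?_ ?_⟩
  · unfold hitValue; split_ifs <;> norm_num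
  · rw [Finset.le_sup'_iff]
    by_cases h : (K ∩ S).Nonempty
    · obtain ⟨e, he⟩ := h
      rw [Finset.mem_inter] at he
      refine ⟨e, he.2, ?_⟩
      have : (K ∩ {e}).Nonempty := ⟨e, by simp [he.1]⟩
      simp only [hitValue, this, if_true]
      split_ifs <;> norm_num
    · obtain ⟨e, he⟩ := hS
      refine ⟨e, he, ?_⟩
      simp only [hitValue, h, if_false]
      split_ifs <;> norm_num
  · refine Finset.sup'_le _ _ fun e he => ?_
    by_cases h : (K ∩ {e}).Nonempty
    · have : (K ∩ S).Nonempty :=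
        h.mono (Finset.inter_subset_inter_left (Finset.singleton_subset_iff.2 he))
      simp [hitValue, h, this]
    · simp only [hitValue, h, if_false]
      split_ifs <;> norm_num

/-- The n items of K can be dealt one to each agent, so the maximin share is at least one and a
bundle that misses K falls short of it. -/
theorem one_le_card_inter_of_isMMS (hn : 1 ≤ n) {K : Finset (Fin m)} (hK : K.card = n)
    {A : Allocation n m} (hA : IsMMSAllocation (fun _ => hitValue K) A) (i : Fin n) :
    1 ≤ (K ∩ bundle A i).card := by
  obtain ⟨f, hf⟩ := exists_deal hn K (fun _ => 1) (by simp [hK])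
  have h1 : (1 : ℝ) ≤ mms n (hitValue K) := by
    refine le_mms hn f fun j => ?_
    have : (K ∩ bundle f j).Nonempty := by
      obtain ⟨e, he⟩ := Finset.card_pos.1 (hf j)
      exact ⟨e, by simpa using he⟩
    simp [hitValue, this]
  have h2 := h1.trans (hA i)
  by_contra hcon
  have : ¬ (K ∩ bundle A i).Nonempty := by rw [← Finset.card_pos]; omega
  simp only [hitValue, this, if_false] at h2
  norm_num at h2

theorem le_card_inter_of_isMMS (hn : 1 ≤ n) {K : Finset (Fin m)} {t : ℕ} (hK : K.card = n * t)
    {A : Allocation n m} (hA : IsMMSAllocation (fun _ => twoValue 1 0 K) A) (i : Fin n) :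
    t ≤ (K ∩ bundle A i).card := by
  obtain ⟨f, hf⟩ := exists_deal hn K (fun _ => t) (by simp [hK])
  have h1 : (t : ℝ) ≤ mms n (twoValue 1 0 K) := by
    refine le_mms hn f fun j => ?_
    rw [twoValue_apply]
    have : K ∩ bundle f j = {e ∈ K | f e = j} := by ext; simp
    rw [this]
    simpa using hf j
  have h2 : (t : ℝ) ≤ twoValue 1 0 K (bundle A i) := h1.trans (hA i)
  rw [twoValue_apply] at h2
  simpa using h2

/-- Two items with the same owner in every allocation of F could be put into a common n-set K, and
no allocation of F would separate them. So an item is determined by its list of owners, of which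
there are at most n^|F|. -/
theorem le_pow_card_outputs (F : Finset (Allocation n m)) (hn : 2 ≤ n) (hm : n ≤ m)
    (h : ∀ K : Finset (Fin m), K.card = n → ∃ A ∈ F, ∀ i, 1 ≤ (K ∩ bundle A i).card) :
    m ≤ n ^ F.card := by
  have hinj : Function.Injective fun (e : Fin m) (A : F) => (A : Allocation n m) e := by
    intro e e' he
    by_contra hne
    obtain ⟨K, hK, hKc⟩ := Finset.exists_superset_card_eq (s := {e, e'}) (n := n)
      (by rw [Finset.card_pair hne]; exact hn) (by simpa using hm)
    obtain ⟨A, hA, hA'⟩ := h K hKc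
    have h1 := card_inter_bundle_eq_of_le (t := 1) (by simpa using hKc) hA' (A e)
    have h2 := congrFun he ⟨A, hA⟩
    simp only at h2
    obtain ⟨y, hy⟩ := Finset.card_eq_one.1 h1
    have h3 : e ∈ K ∩ bundle A (A e) := by simp [hK (show e ∈ ({e, e'} : Finset _) by simp)]
    have h4 : e' ∈ K ∩ bundle A (A e) := by
      simp [hK (show e' ∈ ({e, e'} : Finset _) by simp), h2]
    rw [hy, Finset.mem_singleton] at h3 h4
    exact hne (h3.trans h4.symm)
  simpa using Fintype.card_le_of_injective _ hinj

/-- Separating n-sets gives n ≤ 4 log |F|, separating pairs gives log log m ≤ log |F| + log log n.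
The last term is at most n, hence the constant 1/9. -/
theorem identical_unitDemand_lower : ∃ c : ℝ, 0 < c ∧ ∀ n m : ℕ, 2 ≤ n → 2 * n ≤ m →
    CCAtLeast (identicalInstances n (IsUnitDemand (m := m)))
      (c * (n + Real.logb 2 (Real.logb 2 m))) := by
  refine ⟨1 / 9, by norm_num, fun n m hn hm => ?_⟩
  refine CCAtLeast.of_outputs ⟨fun _ => hitValue ∅, _, isUnitDemand_hitValue _, fun _ => rfl⟩
    fun F hF => ?_
  have h : ∀ K : Finset (Fin m), K.card = n → ∃ A ∈ F, ∀ i, 1 ≤ (K ∩ bundle A i).card := by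
    intro K hK
    obtain ⟨A, hA, hA'⟩ := hF (fun _ => hitValue K) ⟨_, isUnitDemand_hitValue _, fun _ => rfl⟩
    exact ⟨A, hA, one_le_card_inter_of_isMMS (by omega) hK hA'⟩
  have h1 := card_outputs_rainbow F hn hm h
  have h2 := le_pow_card_outputs F hn (by omega) h
  have hn' : (2 : ℝ) ≤ n := by exact_mod_cast hn
  have hm' : (4 : ℝ) ≤ m := by exact_mod_cast (by omega : 4 ≤ m)
  have hF0 : 0 < Real.logb 2 F.card := by linarith
  have hFpos : (0 : ℝ) < F.card := by
    rcases (Nat.cast_nonneg (α := ℝ) F.card).lt_or_eq with h | h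
    · exact h
    · rw [← h] at hF0; simp at hF0
  have h3 : Real.logb 2 m ≤ F.card * Real.logb 2 n := by
    rw [← Real.logb_pow]
    exact Real.logb_le_logb_of_le (by norm_num) (by linarith) (by exact_mod_cast h2)
  have hlm : 0 < Real.logb 2 m := Real.logb_pos (by norm_num) (by linarith)
  have hln : 0 < Real.logb 2 n := Real.logb_pos (by norm_num) (by linarith)
  have h4 : Real.logb 2 (Real.logb 2 m) ≤ Real.logb 2 F.card + Real.logb 2 (Real.logb 2 n) := by
    rw [← Real.logb_mul hFpos.ne' hln.ne']
    exact Real.logb_le_logb_of_le (by norm_num) hlm h3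
  have h6 : Real.logb 2 (Real.logb 2 n) ≤ Real.logb 2 n := by
    refine Real.logb_le_logb_of_le (by norm_num) hln ?_
    rw [Real.logb_le_iff_le_rpow (by norm_num) (by linarith), Real.rpow_natCast]
    exact_mod_cast (Nat.lt_two_pow_self (n := n)).le
  have h7 : Real.logb 2 (n : ℝ) ≤ n := by
    rw [Real.logb_le_iff_le_rpow (by norm_num) (by linarith), Real.rpow_natCast]
    exact_mod_cast (Nat.lt_two_pow_self (n := n)).le
  linarith

theorem identical_binary_lower : ∃ c : ℝ, 0 < c ∧ ∀ n m : ℕ, 2 ≤ n → 2 * n ≤ m →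
    CCAtLeast (identicalInstances n (IsBinary (m := m)))
      (c * (n * Real.logb 2 ((m : ℝ) / n))) := by
  refine ⟨1 / 24, by norm_num, fun n m hn hm => ?_⟩
  have hbin : ∀ K : Finset (Fin m), IsBinary (twoValue 1 0 K) := fun K =>
    isBinary_iff.2 (isTwoValued_twoValue le_rfl one_pos K)
  refine CCAtLeast.of_outputs ⟨fun _ => twoValue 1 0 ∅, _, hbin _, fun _ => rfl⟩ fun F hF => ?_
  have h : ∀ t, ∀ K : Finset (Fin m), K.card = n * t →
      ∃ A ∈ F, ∀ i, t ≤ (K ∩ bundle A i).card := by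
    intro t K hK
    obtain ⟨A, hA, hA'⟩ := hF (fun _ => twoValue 1 0 K) ⟨_, hbin K, fun _ => rfl⟩
    exact ⟨A, hA, le_card_inter_of_isMMS (by omega) hK hA'⟩
  -- The case t = 1 bounds log |F| below by a multiple of n, which absorbs the lower order terms of
  -- the main estimate.
  have h1 := card_outputs_rainbow F hn hm (by simpa using h 1)
  obtain ⟨t, ht⟩ : ∃ t, t = m / (2 * n) := ⟨_, rfl⟩
  have ht1 : 1 ≤ t := by rw [ht, Nat.le_div_iff_mul_le (by omega)]; omega
  have htm : 2 * n * t ≤ m := by rw [ht]; exact Nat.mul_div_le m (2 * n)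
  have htm' : m < 2 * n * (t + 1) := by
    rw [ht]; exact Nat.lt_mul_div_succ m (by omega)
  have h2 := card_outputs_even_split F ht1 (by omega) htm (h t)
  have hn' : (2 : ℝ) ≤ n := by exact_mod_cast hn
  have ht' : (1 : ℝ) ≤ t := by exact_mod_cast ht1
  have hF0 : 0 < Real.logb 2 F.card := by linarith
  have hFpos : (0 : ℝ) < F.card := by
    rcases (Nat.cast_nonneg (α := ℝ) F.card).lt_or_eq with h | h
    · exact h
    · rw [← h] at hF0; simp at hF0
  have hmono : ∀ x y : ℝ, 0 < x → x ≤ y → Real.logb 2 x ≤ Real.logb 2 y := fun x y hx hxy =>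
    Real.logb_le_logb_of_le (by norm_num) hx hxy
  have h3 : n * Real.logb 2 (t + 1) ≤ 2 + Real.logb 2 n + Real.logb 2 (t + 1)
      + 2 * Real.logb 2 F.card := by
    have e1 : ((t : ℝ) + 1) ^ n ≤ 4 * (n * (t + 1)) * (F.card : ℝ) ^ 2 := by
      have : ((t : ℝ) + 1) ^ n ≤ 4 * (n * t) * (F.card : ℝ) ^ 2 := by exact_mod_cast h2
      refine this.trans ?_
      gcongr
      linarith
    have e2 := hmono _ _ (by positivity) e1
    rw [Real.logb_pow, Real.logb_mul (by positivity) (by positivity),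
      Real.logb_mul (by norm_num) (by positivity), Real.logb_mul (by positivity) (by positivity),
      Real.logb_pow] at e2
    have e3 : Real.logb 2 (4 : ℝ) = 2 := by
      rw [show (4 : ℝ) = 2 ^ 2 by norm_num, Real.logb_pow]; simp
    rw [e3] at e2
    push_cast at e2
    linarith
  have h4 : Real.logb 2 ((m : ℝ) / n) ≤ 1 + Real.logb 2 (t + 1) := by
    have e1 : (m : ℝ) / n ≤ 2 * (t + 1) := by
      rw [div_le_iff₀ (by linarith)]
      have : (m : ℝ) ≤ 2 * n * (t + 1) := by exact_mod_cast htm'.le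
      linarith
    have hmpos : (0 : ℝ) < m := by exact_mod_cast (by omega : 0 < m)
    refine (hmono _ _ (by positivity) e1).trans ?_
    rw [Real.logb_mul (by norm_num) (by positivity)]
    simp
  have h5 : Real.logb 2 (n : ℝ) ≤ n := by
    rw [Real.logb_le_iff_le_rpow (by norm_num) (by linarith), Real.rpow_natCast]
    exact_mod_cast (Nat.lt_two_pow_self (n := n)).le
  have h6 : 0 ≤ Real.logb 2 ((t : ℝ) + 1) := Real.logb_nonneg (by norm_num) (by linarith)
  have h7 : (n : ℝ) * Real.logb 2 ((m : ℝ) / n) ≤ n * (1 + Real.logb 2 (t + 1)) := by gcongr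
  nlinarith

end LowerBounds

/-! ### Identical 2-valued valuations: linear lower and upper bounds -/

section TwoValuedIdentical

variable {n m : ℕ}

theorem le_mms_twoValue (hn : 1 ≤ n) {a b μ : ℝ} (ha : 0 ≤ a) (hb : 0 ≤ b) (K : Finset (Fin m))
    (x y : Fin n → ℕ) (hx : ∑ i, x i ≤ K.card) (hy : ∑ i, y i ≤ Kᶜ.card)
    (h : ∀ i, μ ≤ a * x i + b * y i) : μ ≤ mms n (twoValue a b K) := by
  obtain ⟨f, hf⟩ := exists_deal hn K x hx
  obtain ⟨f', hf'⟩ := exists_deal hn Kᶜ y hy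
  refine le_mms hn (fun e => if e ∈ K then f e else f' e) fun j => (h j).trans ?_
  rw [twoValue_apply]
  gcongr
  · refine (hf j).trans (Finset.card_le_card fun e he => ?_)
    simp only [Finset.mem_filter] at he
    simp [he]
  · refine (hf' j).trans (Finset.card_le_card fun e he => ?_)
    simp only [Finset.mem_filter, Finset.mem_compl] at he
    simp [he]

/-- One term of Vandermonde's convolution. -/
theorem choose_mul_choose_le (a b i j : ℕ) :
    a.choose i * b.choose j ≤ (a + b).choose (i + j) := by
  rw [Nat.add_choose_eq]
  exact Finset.single_le_sum (f := fun p : ℕ × ℕ => a.choose p.1 * b.choose p.2)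
    (fun _ _ => Nat.zero_le _) (show (i, j) ∈ Finset.HasAntidiagonal.antidiagonal (i + j) by simp)

theorem prod_choose_le {ι : Type*} (S : Finset ι) (s x : ι → ℕ) :
    ∏ i ∈ S, (s i).choose (x i) ≤ (∑ i ∈ S, s i).choose (∑ i ∈ S, x i) := by
  classical
  induction S using Finset.induction_on with
  | empty => simp
  | insert i S hi ih =>
    rw [Finset.prod_insert hi, Finset.sum_insert hi, Finset.sum_insert hi]
    exact (Nat.mul_le_mul_left _ ih).trans (choose_mul_choose_le _ _ _ _)

/-- Raising t by one multiplies C(s,t) by (s-t)/(t+1) and C(2s,t) by (2s-t)/(t+1), which is at least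
twice as much. -/
theorem choose_mul_two_pow_le (s t : ℕ) : s.choose t * 2 ^ t ≤ (2 * s).choose t := by
  induction t with
  | zero => simp
  | succ t ih =>
    refine Nat.le_of_mul_le_mul_right (c := t + 1) ?_ (by omega)
    calc s.choose (t + 1) * 2 ^ (t + 1) * (t + 1)
        = (s.choose (t + 1) * (t + 1)) * 2 ^ t * 2 := by ring
      _ = (s.choose t * 2 ^ t) * (2 * (s - t)) := by rw [Nat.choose_succ_right_eq]; ring
      _ ≤ (2 * s).choose t * (2 * s - t) := Nat.mul_le_mul ih (by omega)
      _ = _ := (Nat.choose_succ_right_eq _ _).symm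

theorem sum_fin_three_blocks (p o r a b c : ℕ) :
    ∑ i : Fin (p + o + r), (if i.val < p then a else if i.val < p + o then b else c)
      = p * a + o * b + r * c := by
  rw [Fin.sum_univ_eq_sum_range (fun i => if i < p then a else if i < p + o then b else c)]
  rw [Finset.sum_range_add, Finset.sum_range_add]
  congr 1
  · congr 1
    · rw [Finset.sum_congr rfl fun i hi => if_pos (Finset.mem_range.1 hi)]
      simp
    · rw [Finset.sum_congr rfl fun i hi => ?_]
      · rw [Finset.sum_const, Finset.card_range, smul_eq_mul]
      · have := Finset.mem_range.1 hi
        rw [if_neg (by omega), if_pos (by omega)]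
  · rw [Finset.sum_congr rfl fun i _ => ?_]
    · rw [Finset.sum_const, Finset.card_range, smul_eq_mul]
    · rw [if_neg (by omega), if_neg (by omega)]

/-- With values `h + 2` and `h`, a bundle of size `s` that meets the target `h * E` with no waste
up to rounding has this number of items of the larger value. -/
def tightCount (h E s : ℕ) : ℕ := if s + 2 ≤ E then h else if s + 1 ≤ E then (h + 1) / 2 else 0

/-- If the bundles meet the target `h * E` with total waste at most one, then the bundle sizes
determine the number of items of the larger value, and few sets fit these numbers. -/
theorem tight_bundles {h E D k : ℕ} (hodd : h % 2 = 1) (hE : h + 2 ≤ E) (hE' : E ≤ h + 3)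
    (hD : m + D = n * E) (hD1 : n ≤ 2 * D) (hD2 : 2 * D < 3 * n) (hn : 2 ≤ n)
    (hk : 2 * k ≤ h * D + 1) (s x : Fin n → ℕ) (hs : ∑ i, s i = m) (hx : ∑ i, x i = k)
    (hxs : ∀ i, x i ≤ s i) (hv : ∀ i, h * E ≤ h * s i + 2 * x i) :
    (∀ i, x i = tightCount h E (s i)) ∧
      (∏ i, (s i).choose (x i)) * 2 ^ ((n + 7) / 8 * ((h + 1) / 2)) ≤ m.choose k := by
  classical
  -- `w i` is the waste of bundle i, its value beyond the target; the total value leaves room for a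
  -- waste of one in all.
  obtain ⟨w, hw⟩ : ∃ w : Fin n → ℕ, ∀ i, h * s i + 2 * x i = h * E + w i :=
    ⟨fun i => h * s i + 2 * x i - h * E, fun i => (Nat.add_sub_cancel' (hv i)).symm⟩
  have hwsum : ∑ i, w i ≤ 1 := by
    have h1 : ∑ i, (h * s i + 2 * x i) = ∑ i, (h * E + w i) := Finset.sum_congr rfl fun i _ => hw i
    rw [Finset.sum_add_distrib, Finset.sum_add_distrib, ← Finset.mul_sum, ← Finset.mul_sum, hs, hx]
      at h1
    simp only [Finset.sum_const, Finset.card_univ, Fintype.card_fin, smul_eq_mul] at h1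
    have h2 : n * (h * E) = h * m + h * D := by rw [← mul_add, hD]; ring
    omega
  have hw1 : ∀ i, w i ≤ 1 := fun i =>
    (Finset.single_le_sum (fun _ _ => Nat.zero_le _) (Finset.mem_univ i)).trans hwsum
  -- A bundle with at most E - 3 ≤ h items fails even if all are large. Size E - 2 forces h large
  -- items. At size E - 1 the parity of h forces waste one and (h+1)/2 large items. From size E on a
  -- large item would waste at least two, so there is none.
  have key : ∀ i, E ≤ s i + 2 ∧ x i = tightCount h E (s i) ∧ (s i + 1 ≤ E →
      (h + 1) / 2 ≤ x i ∧ s i + 2 ≤ E + w i) ∧ (E ≤ s i → s i ≤ E + w i) := by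
    intro i
    have e1 := hw i
    have e2 := hw1 i
    have e3 := hxs i
    rcases Nat.lt_or_ge (s i + 2) E with hlt | hge
    · exfalso
      have e4 : h * (s i + 3) ≤ h * E := Nat.mul_le_mul_left h (by omega)
      rw [mul_add] at e4
      omega
    rcases Nat.eq_or_lt_of_le hge with heq | hgt
    · have e4 : h * E = h * s i + h * 2 := by rw [heq, mul_add]
      have e5 : x i = h := by omega
      have : tightCount h E (s i) = h := by rw [tightCount, if_pos (by omega)]
      rw [this]
      refine ⟨by omega, e5, fun _ => ⟨by omega, by omega⟩, fun _ => by omega⟩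
    rcases Nat.lt_or_ge (s i) E with hlt | hge'
    · have e6 : E = s i + 1 := by omega
      have e4 : h * E = h * s i + h := by rw [e6, mul_add, mul_one]
      have : tightCount h E (s i) = (h + 1) / 2 := by
        rw [tightCount, if_neg (by omega), if_pos (by omega)]
      rw [this]
      refine ⟨by omega, by omega, fun _ => ⟨by omega, by omega⟩, fun _ => by omega⟩
    · obtain ⟨r, hr⟩ := Nat.exists_eq_add_of_le hge'
      have e4 : h * s i = h * E + h * r := by rw [hr, mul_add]
      have e5 : r ≤ h * r := Nat.le_mul_of_pos_left r (by omega)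
      have : tightCount h E (s i) = 0 := by
        rw [tightCount, if_neg (by omega), if_neg (by omega)]
      rw [this]
      refine ⟨by omega, by omega, fun _ => ⟨by omega, by omega⟩, fun _ => by omega⟩
  refine ⟨fun i => (key i).2.1, ?_⟩
  -- Bundles with fewer than E items contain all large items. As each lacks one or two, their number
  -- is about D / 2 up to a factor two, and the bounds on D leave at least n / 8 bundles on either
  -- side.
  obtain ⟨Lo, hLo⟩ : ∃ Lo : Finset (Fin n), Lo = ({i | s i + 1 ≤ E} : Finset (Fin n)) := ⟨_, rfl⟩
  have memLo : ∀ i, i ∈ Lo ↔ s i + 1 ≤ E := fun i => by simp [hLo]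
  have hcard : Lo.card + Loᶜ.card = n := by simp
  have c1 : D ≤ 2 * Lo.card := by
    have h1 : ∑ _i : Fin n, E ≤ ∑ i, (s i + if i ∈ Lo then 2 else 0) := by
      refine Finset.sum_le_sum fun i _ => ?_
      have := (key i).1
      split_ifs with hi
      · omega
      · rw [memLo] at hi; omega
    rw [Finset.sum_add_distrib, hs, Finset.sum_ite_mem] at h1
    simp at h1
    omega
  have c2 : 2 * Lo.card ≤ D + 1 := by
    have h1 : ∑ i, (s i + if i ∈ Lo then 2 else 0) ≤ ∑ i, (E + w i) := by
      refine Finset.sum_le_sum fun i _ => ?_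
      split_ifs with hi
      · have := ((key i).2.2.1 ((memLo i).1 hi)).2; omega
      · rw [memLo] at hi
        have := (key i).2.2.2 (by omega); omega
    rw [Finset.sum_add_distrib, Finset.sum_add_distrib, hs, Finset.sum_ite_mem] at h1
    simp at h1
    omega
  obtain ⟨L, hL, hLc⟩ := Finset.exists_subset_card_eq (s := Lo) (n := (n + 7) / 8) (by omega)
  have hZe : (n + 7) / 8 ≤ Loᶜ.card := by omega
  -- The bundles outside `Lo` contribute trivial factors, so their items are free to double the
  -- ground sets of the bundles in L. Each doubling raises the binomial coefficient by 2^(x i) with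
  -- x i ≥ (h+1)/2, and the enlarged sizes still sum to at most m.
  obtain ⟨s', hs'⟩ : ∃ s' : Fin n → ℕ, ∀ i, s' i =
      (if i ∈ Lo then s i else 0) + (if i ∈ L then s i else 0) := ⟨_, fun _ => rfl⟩
  have hsum : ∑ i, s' i ≤ m := by
    have h1 : ∑ i ∈ L, s i ≤ ∑ i ∈ Loᶜ, s i := by
      calc ∑ i ∈ L, s i ≤ L.card • E := Finset.sum_le_card_nsmul _ _ _ fun i hi => by
            have := (memLo i).1 (hL hi); omega
        _ ≤ Loᶜ.card • E := by rw [hLc]; exact Nat.mul_le_mul_right _ hZe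
        _ ≤ _ := Finset.card_nsmul_le_sum _ _ _ fun i hi => by
            rw [Finset.mem_compl, memLo] at hi; omega
    simp only [hs', Finset.sum_add_distrib, Finset.sum_ite_mem, Finset.univ_inter]
    have h2 := Finset.sum_add_sum_compl Lo s
    omega
  calc (∏ i, (s i).choose (x i)) * 2 ^ ((n + 7) / 8 * ((h + 1) / 2))
      = ∏ i, ((s i).choose (x i) * if i ∈ L then 2 ^ ((h + 1) / 2) else 1) := by
        rw [Finset.prod_mul_distrib, Finset.prod_ite_mem]
        simp [hLc, pow_mul, mul_comm]
    _ ≤ ∏ i, (s' i).choose (x i) := by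
        refine Finset.prod_le_prod' fun i _ => ?_
        rw [hs']
        by_cases hi : i ∈ L
        · have hi' := hL hi
          simp only [hi, hi', if_true]
          rw [← two_mul]
          refine le_trans ?_ (choose_mul_two_pow_le _ _)
          gcongr
          · norm_num
          · exact ((key i).2.2.1 ((memLo i).1 hi')).1
        · by_cases hi' : i ∈ Lo
          · simp [hi, hi']
          · have hi2 := hi'
            rw [memLo] at hi2
            have : x i = 0 := by
              rw [(key i).2.1, tightCount, if_neg (by omega), if_neg (by omega)]
            simp [hi, this]
    _ ≤ (∑ i, s' i).choose (∑ i, x i) := prod_choose_le _ _ _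
    _ ≤ m.choose k := by rw [hx]; exact Nat.choose_le_choose k hsum

theorem identical_twoValued_lower : ∃ c : ℝ, 0 < c ∧ ∀ n m : ℕ, 2 ≤ n → 2 * n ≤ m →
    ∃ a b : ℝ, 0 ≤ b ∧ b < a ∧
      CCAtLeast (identicalInstances n (IsTwoValued (m := m) a b)) (c * m) := by
  classical
  refine ⟨1 / 48, by norm_num, fun n m hn hm => ?_⟩
  -- E is m/n + 1/2 rounded up, so that the deficit D = nE - m lies between n/2 and 3n/2.
  obtain ⟨E, hE⟩ : ∃ E, E = (2 * m + n + 2 * n - 1) / (2 * n) := ⟨_, rfl⟩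
  have hE1 : 2 * m + n ≤ 2 * n * E := by
    have := Nat.lt_mul_div_succ (2 * m + n + 2 * n - 1) (show 0 < 2 * n by omega)
    rw [← hE, mul_add] at this
    omega
  have hE2 : 2 * n * E < 2 * m + 3 * n := by
    have := Nat.mul_div_le (2 * m + n + 2 * n - 1) (2 * n)
    rw [← hE] at this
    omega
  have hE3 : 3 ≤ E := by
    by_contra hcon
    have : 2 * n * E ≤ 2 * n * 2 := Nat.mul_le_mul_left _ (by omega)
    omega
  obtain ⟨D, hD⟩ : ∃ D, m + D = n * E := ⟨n * E - m, by
    have : 2 * n * E = 2 * (n * E) := by ring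
    omega⟩
  have hDE : 2 * n * E = 2 * (n * E) := by ring
  obtain ⟨h, hodd, hhE, hhE'⟩ : ∃ h, h % 2 = 1 ∧ h + 2 ≤ E ∧ E ≤ h + 3 := by
    rcases Nat.even_or_odd' E with ⟨j, hj | hj⟩
    · exact ⟨E - 3, by omega, by omega, by omega⟩
    · exact ⟨E - 2, by omega, by omega, by omega⟩
  obtain ⟨g, hg⟩ : ∃ g, h + 1 = 2 * g := ⟨(h + 1) / 2, by omega⟩
  -- The model partition: p bundles of E - 2 items with h large ones, o of E - 1 items with g large
  -- ones, and r of E small items. Only the o ≤ 1 middle bundle wastes anything, namely one.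
  obtain ⟨p, o, hpo, ho⟩ : ∃ p o, D = 2 * p + o ∧ o ≤ 1 := ⟨D / 2, D % 2, by omega, by omega⟩
  obtain ⟨r, hr⟩ : ∃ r, n = p + o + r := ⟨n - p - o, by omega⟩
  obtain ⟨k, hk⟩ : ∃ k, k = p * h + o * g := ⟨_, rfl⟩
  have hk2 : 2 * k = h * D + o := by
    rw [hk, hpo]
    have : o * (2 * g) = o * (h + 1) := by rw [hg]
    linarith
  have hsize : p * (E - 2) + o * (E - 1) + r * E = m := by
    obtain ⟨E', rfl⟩ : ∃ E', E = E' + 2 := ⟨E - 2, by omega⟩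
    rw [show E' + 2 - 2 = E' by omega, show E' + 2 - 1 = E' + 1 by omega]
    rw [hr, hpo] at hD
    linarith
  have hrest : p * (E - 2 - h) + o * (E - 1 - g) + r * E = m - k := by
    obtain ⟨E', rfl⟩ : ∃ E', E = E' + h + 2 := ⟨E - h - 2, by omega⟩
    obtain ⟨h', hh'⟩ : ∃ h', h = g + h' := ⟨h - g, by omega⟩
    rw [show E' + h + 2 - 2 - h = E' by omega,
      show E' + h + 2 - 1 - g = E' + h' + 1 by omega]
    rw [show E' + h + 2 - 2 = E' + h by omega, show E' + h + 2 - 1 = E' + h + 1 by omega] at hsize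
    have : m = p * E' + o * (E' + h' + 1) + r * (E' + h + 2) + k := by
      rw [← hsize, hk, hh']; ring
    omega
  have hkm : k ≤ m := by
    rw [hk, ← hsize]
    have h1 : p * h ≤ p * (E - 2) := Nat.mul_le_mul_left _ (by omega)
    have h2 : o * g ≤ o * (E - 1) := Nat.mul_le_mul_left _ (by omega)
    omega
  have hab : (h : ℝ) < (h + 2 : ℕ) := by exact_mod_cast (by omega : h < h + 2)
  have htwo : ∀ K : Finset (Fin m), IsTwoValued ((h + 2 : ℕ) : ℝ) (h : ℝ)
      (twoValue ((h + 2 : ℕ) : ℝ) (h : ℝ) K) := fun K => isTwoValued_twoValue (by positivity) hab K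
  refine ⟨(h + 2 : ℕ), h, by positivity, hab, CCAtLeast.of_outputs
    ⟨fun _ => twoValue _ _ ∅, _, htwo ∅, fun _ => rfl⟩ fun F hF => ?_⟩
  have hserve : ∀ K : Finset (Fin m), K.card = k → ∃ A ∈ F, ∀ i,
      h * E ≤ h * (bundle A i).card + 2 * (K ∩ bundle A i).card := by
    intro K hK
    obtain ⟨A, hA, hA'⟩ := hF (fun _ => twoValue _ _ K) ⟨_, htwo K, fun _ => rfl⟩
    refine ⟨A, hA, fun i => ?_⟩
    have h1 : ((h * E : ℕ) : ℝ) ≤ mms n (twoValue ((h + 2 : ℕ) : ℝ) (h : ℝ) K) := by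
      have hvals : ∀ j < n, h * E ≤
          (h + 2) * (if j < p then h else if j < p + o then g else 0) +
          h * (if j < p then E - 2 - h else if j < p + o then E - 1 - g else E) := by
        intro j _
        split_ifs
        · rw [show E = E - 2 - h + h + 2 by omega]
          generalize E - 2 - h = E'
          rw [show E' + h + 2 - 2 - h = E' by omega]
          exact le_of_eq (by ring)
        · rw [show E = E - 1 - g + g + 1 by omega]
          generalize E - 1 - g = E'
          rw [show E' + g + 1 - 1 - g = E' by omega]
          calc h * (E' + g + 1) = h * g + h * E' + h := by ring
            _ ≤ h * g + h * E' + 2 * g := by omega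
            _ = _ := by ring
        · simp
      clear hsize hk2 hDE hE2 hE1 hD
      subst hr
      refine le_mms_twoValue (by omega) (by positivity) (by positivity) K
        (fun i => if i.val < p then h else if i.val < p + o then g else 0)
        (fun i => if i.val < p then E - 2 - h else if i.val < p + o then E - 1 - g else E)
        ?_ ?_ fun i => ?_
      · rw [sum_fin_three_blocks, hK, hk]; simp
      · rw [sum_fin_three_blocks, Finset.card_compl, hK, hrest]; simp
      · exact_mod_cast hvals i i.isLt
    have h2 : ((h * E : ℕ) : ℝ) ≤ twoValue ((h + 2 : ℕ) : ℝ) (h : ℝ) K (bundle A i) :=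
      h1.trans (hA' i)
    rw [twoValue_eq] at h2
    have h3 : ((h * E : ℕ) : ℝ)
        ≤ ((h * (bundle A i).card + 2 * (K ∩ bundle A i).card : ℕ) : ℝ) := by
      push_cast at h2 ⊢
      linarith
    exact_mod_cast h3
  have htight : ∀ K : Finset (Fin m), K.card = k → ∀ A : Allocation n m,
      (∀ i, h * E ≤ h * (bundle A i).card + 2 * (K ∩ bundle A i).card) →
      (∀ i, (K ∩ bundle A i).card = tightCount h E (bundle A i).card) ∧
      (∏ i, (bundle A i).card.choose (K ∩ bundle A i).card) * 2 ^ ((n + 7) / 8 * ((h + 1) / 2))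
        ≤ m.choose k := fun K hK A hA =>
    tight_bundles hodd hhE hhE' hD (by omega) (by omega) hn (by omega)
      (fun i => (bundle A i).card) (fun i => (K ∩ bundle A i).card) (sum_card_bundle A)
      (by rw [sum_card_inter_bundle, hK]) (fun i => Finset.card_le_card Finset.inter_subset_right)
      hA
  -- The product bound holds only for allocations that serve at least one K, so the others are
  -- discarded.
  set F' := F.filter fun A => ∃ K : Finset (Fin m), K.card = k ∧
    ∀ i, h * E ≤ h * (bundle A i).card + 2 * (K ∩ bundle A i).card
  have h1 := choose_le_sum_prod_choose F' Finset.univ k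
    (fun A i => tightCount h E (bundle A i).card) fun K _ hK => by
      obtain ⟨A, hA, hA'⟩ := hserve K hK
      exact ⟨A, Finset.mem_filter.2 ⟨hA, K, hK, hA'⟩, (htight K hK A hA').1⟩
  simp only [Finset.card_univ, Fintype.card_fin, Finset.univ_inter] at h1
  set X := (n + 7) / 8 * ((h + 1) / 2)
  have h2 : m.choose k * 2 ^ X ≤ m.choose k * F.card := by
    calc m.choose k * 2 ^ X
        ≤ (∑ A ∈ F', ∏ i, (bundle A i).card.choose (tightCount h E (bundle A i).card)) * 2 ^ X := by
          gcongr
      _ = ∑ A ∈ F', (∏ i, (bundle A i).card.choose (tightCount h E (bundle A i).card)) * 2 ^ X :=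
          Finset.sum_mul _ _ _
      _ ≤ F'.card • m.choose k := Finset.sum_le_card_nsmul _ _ _ fun A hA => by
          obtain ⟨-, K, hK, hA'⟩ := Finset.mem_filter.1 hA
          have := htight K hK A hA'
          simpa only [this.1] using this.2
      _ ≤ F.card * m.choose k := Nat.mul_le_mul_right _ (Finset.card_filter_le _ _)
      _ = _ := mul_comm _ _
  have h3 : 2 ^ X ≤ F.card := Nat.le_of_mul_le_mul_left h2 (Nat.choose_pos hkm)
  have hF0 : 0 < F.card := lt_of_lt_of_le (by positivity) h3
  have h4 : (X : ℝ) ≤ Real.logb 2 F.card := by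
    rw [Real.le_logb_iff_rpow_le (by norm_num) (by exact_mod_cast hF0), Real.rpow_natCast]
    exact_mod_cast h3
  have h5 : m ≤ 48 * X := by
    have e1 : n ≤ 8 * ((n + 7) / 8) := by omega
    have e2 : E ≤ 6 * ((h + 1) / 2) := by omega
    calc m ≤ n * E := by omega
      _ ≤ (8 * ((n + 7) / 8)) * (6 * ((h + 1) / 2)) := Nat.mul_le_mul e1 e2
      _ = 48 * X := by ring
  have h6 : (m : ℝ) ≤ 48 * X := by exact_mod_cast h5
  linarith

/-- One agent sends the indicator vector of her large items, which determines the common valuation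
and a partition that attains the maximin share. -/
theorem identical_twoValued_upper : ∃ c : ℝ, 0 < c ∧ ∀ n m : ℕ, 1 ≤ n → 2 * n ≤ m →
    ∀ a b : ℝ, 0 ≤ b → b < a →
      CCAtMost (identicalInstances n (IsTwoValued (m := m) a b)) (c * m) := by
  refine ⟨1, one_pos, fun n m hn _ a b _ _ => ?_⟩
  choose P hP using fun v : ItemValuation m => exists_mms_partition hn v
  obtain ⟨t, ht⟩ := Dialogue.exists_send (α := Finset (Fin m)) (n := n) (m := m) ⟨0, hn⟩ m
    (by simp) (fun u => bigItems a u)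
  refine CCAtMost.of_dialogue (t.bind fun K => .done (P (twoValue a b K))) ?_ ?_
  · rintro v ⟨u, hu, hv⟩ i
    have := hu.eq_twoValue
    simp only [Dialogue.run_bind, (ht v).1, Dialogue.run_done, hv]
    rw [← this]
    exact hP u i
  · rintro v -
    simp [(ht v).2]

end TwoValuedIdentical

/-! ### 2-valued valuations: picking large items in order -/

section TwoValuedUpper

variable {n m : ℕ}

/-- Disjoint sets can be enlarged to the bundles of an allocation with prescribed sizes. -/
theorem exists_allocation_extending (hn : 1 ≤ n) (S : Fin n → Finset (Fin m))
    (hS : Pairwise fun i j => Disjoint (S i) (S j)) (s : Fin n → ℕ) (hSs : ∀ i, (S i).card ≤ s i)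
    (hs : ∑ i, s i ≤ m) :
    ∃ A : Allocation n m, ∀ i, S i ⊆ bundle A i ∧ s i ≤ (bundle A i).card := by
  classical
  obtain ⟨f, hf⟩ := exists_deal hn (Finset.univ.biUnion S)ᶜ (fun i => s i - (S i).card) (by
    rw [Finset.card_compl, Finset.card_biUnion fun i _ j _ hij => hS hij, Fintype.card_fin]
    have h1 : ∑ i, (s i - (S i).card) + ∑ i, (S i).card = ∑ i, s i := by
      rw [← Finset.sum_add_distrib]
      exact Finset.sum_congr rfl fun i _ => Nat.sub_add_cancel (hSs i)
    omega)
  let A : Allocation n m := fun e => if h : ∃ i, e ∈ S i then h.choose else f e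
  have hA : ∀ i, ∀ e ∈ S i, A e = i := by
    intro i e he
    have h : ∃ i, e ∈ S i := ⟨i, he⟩
    simp only [A, h, dif_pos]
    by_contra hne
    exact Finset.disjoint_left.1 (hS hne) h.choose_spec he
  refine ⟨A, fun i => ⟨fun e he => by simpa using hA i e he, ?_⟩⟩
  have hsub : S i ∪ {e ∈ (Finset.univ.biUnion S)ᶜ | f e = i} ⊆ bundle A i := by
    intro e he
    rcases Finset.mem_union.1 he with he | he
    · simpa using hA i e he
    · simp only [Finset.mem_filter, Finset.mem_compl, Finset.mem_biUnion, Finset.mem_univ,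
        true_and] at he
      simp [A, he.1, he.2]
  have hdisj : Disjoint (S i) {e ∈ (Finset.univ.biUnion S)ᶜ | f e = i} := by
    rw [Finset.disjoint_left]
    intro e he he'
    simp only [Finset.mem_filter, Finset.mem_compl, Finset.mem_biUnion, Finset.mem_univ,
      true_and] at he'
    exact he'.1 ⟨i, he⟩
  have := Finset.card_le_card hsub
  rw [Finset.card_union_of_disjoint hdisj] at this
  have := hf i
  omega

/-- Only counts matter: x i large items are reserved for each bundle, which is then filled up to s i
items. Surplus items, or large ones among the filling, do no harm since 0 ≤ b ≤ a. -/
theorem le_mms_of_counts (hn : 1 ≤ n) {a b μ : ℝ} (hb : 0 ≤ b) (hab : b ≤ a)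
    (K : Finset (Fin m)) (x s : Fin n → ℕ) (hx : ∑ i, x i ≤ K.card) (hs : ∑ i, s i ≤ m)
    (hxs : ∀ i, x i ≤ s i) (h : ∀ i, μ ≤ b * s i + (a - b) * x i) :
    μ ≤ mms n (twoValue a b K) := by
  obtain ⟨f, hf⟩ := exists_deal hn K x hx
  choose S hS hSc using fun i => Finset.exists_subset_card_eq (hf i)
  obtain ⟨A, hA⟩ := exists_allocation_extending hn S (fun i j hij => by
    refine Finset.disjoint_left.2 fun e hi hj => ?_
    have h1 := hS i hi
    have h2 := hS j hj
    simp only [Finset.mem_filter] at h1 h2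
    exact hij (h1.2.symm.trans h2.2)) s (fun i => by rw [hSc]; exact hxs i) hs
  refine le_mms hn A fun i => (h i).trans ?_
  rw [twoValue_eq]
  have h0 : 0 ≤ a - b := by linarith
  gcongr
  · exact (hA i).2
  · rw [← hSc i]
    refine Finset.card_le_card fun e he => ?_
    exact Finset.mem_inter.2 ⟨(Finset.mem_filter.1 (hS i he)).1, (hA i).1 he⟩

theorem mms_twoValue_mono (hn : 1 ≤ n) {a b : ℝ} (hb : 0 ≤ b) (hab : b ≤ a)
    {K K' : Finset (Fin m)} (h : K.card ≤ K'.card) :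
    mms n (twoValue a b K) ≤ mms n (twoValue a b K') := by
  obtain ⟨P, hP⟩ := exists_mms_partition hn (twoValue a b K)
  refine le_mms_of_counts hn hb hab K' (fun i => (K ∩ bundle P i).card)
    (fun i => (bundle P i).card) (by rwa [sum_card_inter_bundle]) (sum_card_bundle P).le
    (fun i => Finset.card_le_card Finset.inter_subset_right) fun i => ?_
  rw [← twoValue_eq]
  exact hP i

/-- Ordered instances: if agent `i`, who has `k i` large items, can cut the items into `n` bundles
worth `μ i` to her, then there are bundles for all agents with large items taken in order. -/
theorem exists_ordered_bundles {a b : ℝ} (n m : ℕ) (k : Fin n → ℕ)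
    (μ : Fin n → ℝ) (hk : Monotone k) (hμ : Monotone μ)
    (h : ∀ i, ∃ x s : Fin n → ℕ, ∑ t, x t ≤ k i ∧ ∑ t, s t ≤ m ∧ (∀ t, x t ≤ s t) ∧
      ∀ t, μ i ≤ b * s t + (a - b) * x t) :
    ∃ x s : Fin n → ℕ, (∀ i, (∑ j, if j ≤ i then x j else 0) ≤ k i) ∧ ∑ t, s t ≤ m ∧
      (∀ t, x t ≤ s t) ∧ ∀ i, μ i ≤ b * s i + (a - b) * x i := by
  induction n generalizing m with
  | zero => exact ⟨Fin.elim0, Fin.elim0, fun i => i.elim0, by simp, fun i => i.elim0,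
      fun i => i.elim0⟩
  | succ n ih =>
    obtain ⟨x, s, hx, hs, hxs, hv⟩ := h (Fin.last n)
    -- The last agent, with the most large items, will receive the smallest bundle t₀ of her own
    -- cut.
    obtain ⟨t₀, -, ht₀⟩ := Finset.exists_min_image Finset.univ s ⟨Fin.last n, Finset.mem_univ _⟩
    have hmin : (n + 1) * s t₀ ≤ m := by
      refine le_trans ?_ hs
      simpa using Finset.card_nsmul_le_sum Finset.univ s (s t₀) fun i _ => ht₀ i (Finset.mem_univ i)
    rw [Fin.sum_univ_succAbove _ t₀] at hx hs
    obtain ⟨x', s', hx', hs', hxs', hv'⟩ := ih (m - s t₀)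
      -- The cap ensures that at least x t₀ large items remain for the last agent.
      (fun j => min (k j.castSucc) (k (Fin.last n) - x t₀)) (fun j => μ j.castSucc)
      (fun i j hij => min_le_min_right _ (hk (Fin.castSucc_le_castSucc_iff.2 hij)))
      (fun i j hij => hμ (Fin.castSucc_le_castSucc_iff.2 hij)) (fun j => by
        -- If the cap binds, the other bundles of the last agent also suffice for agent j, by
        -- monotonicity of μ. Otherwise agent j keeps her own cut without its largest bundle.
        rcases le_total (k (Fin.last n) - x t₀) (k j.castSucc) with hz | hz
        · refine ⟨fun t => x (t₀.succAbove t), fun t => s (t₀.succAbove t), ?_,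
            by beta_reduce; omega, fun t => hxs _, fun t => (hμ (Fin.le_last _)).trans (hv _)⟩
          rw [min_eq_right hz]; beta_reduce; omega
        · obtain ⟨y, r, hy, hr, hyr, hw⟩ := h j.castSucc
          obtain ⟨t₁, -, ht₁⟩ := Finset.exists_max_image Finset.univ r
            ⟨Fin.last n, Finset.mem_univ _⟩
          rw [Fin.sum_univ_succAbove _ t₁] at hy hr
          refine ⟨fun t => y (t₁.succAbove t), fun t => r (t₁.succAbove t), ?_, ?_,
            fun t => hyr _, fun t => hw _⟩
          · rw [min_eq_left hz]; beta_reduce; omega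
          · beta_reduce
            rcases le_total (s t₀) (r t₁) with h1 | h1
            · omega
            -- Here all her bundles have at most s t₀ items, and (n+1) s t₀ ≤ m, so the n remaining
            -- ones fit into m - s t₀ items.
            · have : ∑ t, r (t₁.succAbove t) ≤ n * s t₀ := by
                simpa using Finset.sum_le_card_nsmul Finset.univ (fun t => r (t₁.succAbove t))
                  (s t₀) fun i _ => (ht₁ _ (Finset.mem_univ _)).trans h1
              rw [add_mul] at hmin
              omega)
    refine ⟨Fin.snoc x' (x t₀), Fin.snoc s' (s t₀), fun i => ?_, ?_, fun i => ?_, fun i => ?_⟩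
    · refine Fin.lastCases ?_ (fun i => ?_) i
      · simp only [Fin.sum_univ_castSucc, Fin.snoc_castSucc, Fin.snoc_last, Fin.le_last, if_true]
        rcases n with _ | n
        · have h0 : x t₀ ≤ k (Fin.last 0) := by omega
          simpa using h0
        · have h1 := hx' (Fin.last n)
          simp only [Fin.le_last, if_true] at h1
          have h2 := h1.trans (min_le_right _ _)
          omega
      · simp only [Fin.sum_univ_castSucc, Fin.snoc_castSucc, Fin.snoc_last,
          Fin.castSucc_le_castSucc_iff]
        rw [if_neg (not_le.2 (Fin.castSucc_lt_last i)), add_zero]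
        exact (hx' i).trans (min_le_left _ _)
    · simp only [Fin.sum_univ_castSucc, Fin.snoc_castSucc, Fin.snoc_last]
      omega
    · refine Fin.lastCases ?_ (fun i => ?_) i
      · simpa using hxs t₀
      · simpa using hxs' i
    · refine Fin.lastCases ?_ (fun i => ?_) i
      · simpa using hv t₀
      · simpa using hv' i

theorem mms_twoValue_le (hn : 1 ≤ n) {a b : ℝ} (hab : b ≤ a) (ha : 0 ≤ a) {r : ℕ}
    (hr : m ≤ n * r) (K : Finset (Fin m)) : mms n (twoValue a b K) ≤ a * r := by
  obtain ⟨P, hP⟩ := exists_mms_partition hn (twoValue a b K)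
  have h1 : ∑ _i : Fin n, mms n (twoValue a b K) ≤ ∑ i, a * (bundle P i).card := by
    refine Finset.sum_le_sum fun i _ => (hP i).trans ?_
    rw [twoValue_eq]
    have : ((K ∩ bundle P i).card : ℝ) ≤ (bundle P i).card := by
      exact_mod_cast Finset.card_le_card Finset.inter_subset_right
    nlinarith
  rw [← Finset.mul_sum, ← Nat.cast_sum, sum_card_bundle] at h1
  simp only [Finset.sum_const, Finset.card_univ, Fintype.card_fin, nsmul_eq_mul] at h1
  have h2 : a * (m : ℝ) ≤ n * (a * r) := by
    have : (m : ℝ) ≤ n * r := by exact_mod_cast hr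
    nlinarith
  have hn' : (0 : ℝ) < n := by exact_mod_cast hn
  exact le_of_mul_le_mul_left (h1.trans h2) hn'

/-- From the numbers of large items alone one finds an order of the agents and the numbers of
large items, at most `r`, and of all items that each of them should get. -/
theorem exists_schedule (hn : 1 ≤ n) {a b : ℝ} (hb : 0 ≤ b) (hab : b ≤ a) {r : ℕ}
    (hr : m ≤ n * r) (k : Fin n → ℕ) (hk : ∀ i, k i ≤ m) :
    ∃ (σ : Equiv.Perm (Fin n)) (x s : Fin n → ℕ),
      (∀ i, (∑ j, if j ≤ i then x (σ j) else 0) ≤ k (σ i)) ∧ ∑ t, s t ≤ m ∧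
      (∀ t, x t ≤ s t) ∧ (∀ t, x t ≤ r) ∧
      ∀ i (K : Finset (Fin m)), K.card = k i →
        mms n (twoValue a b K) ≤ b * s i + (a - b) * x i := by
  choose K hK hKc using fun i => Finset.exists_subset_card_eq
    (s := (Finset.univ : Finset (Fin m))) (n := k i) (by simpa using hk i)
  have hmono := Tuple.monotone_sort k
  obtain ⟨x, s, hx, hs, hxs, hv⟩ := exists_ordered_bundles n m (k ∘ Tuple.sort k)
    (fun i => mms n (twoValue a b (K (Tuple.sort k i)))) hmono
    (fun i j hij => mms_twoValue_mono hn hb hab (by rw [hKc, hKc]; exact hmono hij))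
    (fun i => by
      obtain ⟨P, hP⟩ := exists_mms_partition hn (twoValue a b (K (Tuple.sort k i)))
      refine ⟨fun t => (K (Tuple.sort k i) ∩ bundle P t).card, fun t => (bundle P t).card,
        by rw [sum_card_inter_bundle, hKc]; rfl, (sum_card_bundle P).le,
        fun t => Finset.card_le_card Finset.inter_subset_right, fun t => ?_⟩
      rw [← twoValue_eq]
      exact hP t)
  set σ := Tuple.sort k
  -- No maximin share exceeds a * r, so a bundle with more than r large items may be replaced by r
  -- large items alone. This cap keeps the later messages short.
  refine ⟨σ, fun i => min (x (σ.symm i)) r,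
    fun i => if x (σ.symm i) ≤ r then s (σ.symm i) else r, fun i => ?_, ?_, fun i => ?_,
    fun i => min_le_right _ _, fun i K' hK' => ?_⟩
  · refine le_trans (Finset.sum_le_sum fun j _ => ?_) (hx i)
    split_ifs
    · simp
    · rfl
  · rw [← Equiv.sum_comp σ]
    refine le_trans (Finset.sum_le_sum fun j _ => ?_) hs
    have := hxs j
    simp only [Equiv.symm_apply_apply]
    split_ifs <;> omega
  · have := hxs (σ.symm i)
    dsimp only
    split_ifs <;> omega
  · have h1 : mms n (twoValue a b K') ≤ mms n (twoValue a b (K i)) :=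
      mms_twoValue_mono hn hb hab (by rw [hK', hKc])
    dsimp only
    split_ifs with hle
    · rw [min_eq_left hle]
      have := hv (σ.symm i)
      simp only [Equiv.apply_symm_apply] at this
      exact h1.trans this
    · rw [min_eq_right (by omega)]
      have := mms_twoValue_le hn hab (hb.trans hab) hr K'
      linarith

theorem foldl_invariant {σ ι : Type*} (step : σ → ι → σ) (I : List ι → σ → Prop) (l : List ι)
    (h : ∀ p i q s, l = p ++ i :: q → I p s → I (p ++ [i]) (step s i)) (s₀ : σ) (h₀ : I [] s₀) :
    I l (l.foldl step s₀) := by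
  induction l using List.reverseRecOn with
  | nil => exact h₀
  | append_singleton l i ih =>
    rw [List.foldl_append]
    refine h l i [] _ rfl (ih fun p j q s hl hI => h p j (q ++ [i]) s ?_ hI)
    rw [hl]; simp

/-- Agents who pick in order, each from what the earlier ones left. -/
theorem exists_picking_dialogue {α : Type} [Finite α] (L r : ℕ)
    (hL : Nat.card {T : Finset α // T.card ≤ r} ≤ 2 ^ L)
    (K : ItemValuation m → Finset α) (σ : Equiv.Perm (Fin n)) (x : Fin n → ℕ)
    (hxr : ∀ i, x i ≤ r) :
    ∃ t : Dialogue n m (Fin n → Finset α), ∀ v, (∀ i, t.cost v i = L) ∧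
      ((∀ i, (∑ j, if j ≤ i then x (σ j) else 0) ≤ (K (v (σ i))).card) →
        (∀ i, t.run v i ⊆ K (v i) ∧ (t.run v i).card = x i) ∧
        Pairwise fun i j => Disjoint (t.run v i) (t.run v j)) := by
  classical
  -- The empty pick is a default for histories in which too few elements are left.
  have hpick : ∀ (i : Fin n) (T : Finset α),
      ∃ S : {S : Finset α // S.card ≤ r}, x i ≤ T.card → S.1 ⊆ T ∧ S.1.card = x i := by
    intro i T
    by_cases h : x i ≤ T.card
    · obtain ⟨S, hS, hSc⟩ := Finset.exists_subset_card_eq h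
      exact ⟨⟨S, by rw [hSc]; exact hxr i⟩, fun _ => ⟨hS, hSc⟩⟩
    · exact ⟨⟨∅, by simp⟩, fun h' => absurd h' h⟩
  choose pick hpick using hpick
  choose send hsend using fun (g : Fin n → Finset α) (i : Fin n) =>
    Dialogue.exists_send i L hL fun u => pick i (K u \ Finset.univ.biUnion g)
  let step : (Fin n → Finset α) → Fin n → Dialogue n m (Fin n → Finset α) :=
    fun g i => (send g i).bind fun S => .done (Function.update g i S.1)
  refine ⟨Dialogue.foldl step (fun _ => ∅) (List.ofFn σ), fun v => ⟨?_, fun hv => ?_⟩⟩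
  · rw [Dialogue.cost_foldl step _ _ v (fun i => Pi.single i L) fun g i => by simp [step, hsend]]
    rw [List.map_ofFn, List.sum_ofFn]
    have : ∑ j, ((fun i => (Pi.single i L : Fin n → ℕ)) ∘ σ) j = fun _ => L := by
      rw [← Finset.univ_sum_single (fun _ : Fin n => L)]
      exact Equiv.sum_comp σ fun i => (Pi.single i L : Fin n → ℕ)
    rw [this]
    exact fun _ => rfl
  · rw [Dialogue.run_foldl]
    have hnodup : (List.ofFn σ).Nodup := List.nodup_ofFn.2 σ.injective
    have := foldl_invariant (fun g i => (step g i).run v)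
      (fun p g => (∀ i ∈ p, g i ⊆ K (v i) ∧ (g i).card = x i) ∧ (∀ i ∉ p, g i = ∅) ∧
        Pairwise fun i j => Disjoint (g i) (g j)) (List.ofFn σ) ?_ (fun _ => ∅) (by
          refine ⟨by simp, by simp, fun i j _ => by simp⟩)
    · refine ⟨fun i => this.1 i ?_, this.2.2⟩
      rw [List.mem_ofFn]
      exact σ.surjective i
    · rintro p i q g hl ⟨h1, h2, h3⟩
      rw [hl] at hnodup
      have hnodup' := hnodup
      rw [List.nodup_append] at hnodup
      have hip : i ∉ p := fun hi => hnodup.2.2 i hi i (by simp) rfl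
      have hsum : (Finset.univ.biUnion g).card = (p.map x).sum := by
        rw [Finset.card_biUnion fun i _ j _ hij => h3 hij, ← List.sum_toFinset x hnodup.1]
        symm
        rw [← Finset.sum_subset (Finset.subset_univ p.toFinset)]
        · exact Finset.sum_congr rfl fun j hj => ((h1 j (by simpa using hj)).2).symm
        · intro j _ hj
          rw [h2 j (by simpa using hj)]; rfl
      have hlen : p.length < n := by
        have := congrArg List.length hl
        simp at this; omega
      have hi : σ ⟨p.length, hlen⟩ = i := by
        have : (List.ofFn σ)[p.length]? = some i := by rw [hl]; simp
        rw [List.getElem?_ofFn] at this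
        simpa [hlen] using this
      have hk := hv ⟨p.length, hlen⟩
      rw [hi] at hk
      have hpx : (p.map x).sum + x i = ∑ j, if j ≤ ⟨p.length, hlen⟩ then x (σ j) else 0 := by
        have e1 : (p.map x).sum + x i = ((List.ofFn (x ∘ σ)).take (p.length + 1)).sum := by
          rw [← List.map_ofFn, hl, List.map_append, List.map_cons]
          simp [List.take_append, List.take_of_length_le]
        rw [e1, List.sum_take_ofFn, Finset.sum_filter]
        refine Finset.sum_congr rfl fun j _ => ?_
        simp only [Fin.le_def, Nat.lt_succ_iff, Function.comp]
      -- Earlier picks destroy at most as many candidates as they have elements; the prefix sum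
      -- condition provides for exactly this loss.
      have hroom : x i ≤ (K (v i) \ Finset.univ.biUnion g).card := by
        have := Finset.le_card_sdiff (Finset.univ.biUnion g) (K (v i))
        omega
      obtain ⟨hs1, hs2⟩ := hpick i _ hroom
      have hrun : (step g i).run v =
          Function.update g i (pick i (K (v i) \ Finset.univ.biUnion g)).1 := by
        simp [step, hsend]
      rw [hrun]
      set S := (pick i (K (v i) \ Finset.univ.biUnion g)).1
      have hSg : ∀ j, Disjoint S (g j) := fun j => by
        refine Finset.disjoint_of_subset_left hs1 ?_
        rw [Finset.disjoint_left]
        intro e he hej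
        exact (Finset.mem_sdiff.1 he).2 (Finset.mem_biUnion.2 ⟨j, Finset.mem_univ j, hej⟩)
      refine ⟨fun j hj => ?_, fun j hj => ?_, fun j j' hjj' => ?_⟩
      · by_cases hji : j = i
        · subst hji
          rw [Function.update_self]
          exact ⟨hs1.trans Finset.sdiff_subset, hs2⟩
        · rw [Function.update_of_ne hji]
          exact h1 j (by simpa [hji] using hj)
      · have hji : j ≠ i := fun h => hj (by simp [h])
        rw [Function.update_of_ne hji]
        exact h2 j fun h => hj (by simp [h])
      · beta_reduce
        by_cases hji : j = i
        · subst hji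
          rw [Function.update_self, Function.update_of_ne (Ne.symm hjj')]
          exact hSg j'
        · rw [Function.update_of_ne hji]
          by_cases hji' : j' = i
          · subst hji'
            rw [Function.update_self]
            exact (hSg j).symm
          · rw [Function.update_of_ne hji']
            exact h3 hjj'

/-- Two rounds: the numbers of large items, L₁ bits each, fix a schedule; then each agent picks her
large items in the scheduled order with L₂ bits. The rest is dealt without communication to reach
the scheduled sizes. -/
theorem exists_twoValued_dialogue (hn : 1 ≤ n) {a b : ℝ} (hb : 0 ≤ b) (hab : b ≤ a) {r L₁ L₂ : ℕ}
    (hr : m ≤ n * r) (h₁ : m + 1 ≤ 2 ^ L₁)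
    (h₂ : Nat.card {T : Finset (Fin m) // T.card ≤ r} ≤ 2 ^ L₂) :
    ∃ t : Dialogue n m (Allocation n m), ∀ v ∈ instances n (IsTwoValued (m := m) a b),
      IsMMSAllocation v (t.run v) ∧ ∀ i, t.cost v i = L₁ + L₂ := by
  classical
  choose send hsend using fun i : Fin n =>
    Dialogue.exists_send (α := Fin (m + 1)) i L₁ (by simpa using h₁) fun u : ItemValuation m =>
      ⟨(bigItems a u).card, Nat.lt_succ_of_le (by simpa using Finset.card_le_univ (bigItems a u))⟩
  obtain ⟨t₁, ht₁⟩ := Dialogue.exists_gather send Finset.univ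
  have hcont : ∀ k : Fin n → Fin (m + 1), ∃ t : Dialogue n m (Allocation n m),
      ∀ v, (∀ i, t.cost v i = L₂) ∧ (v ∈ instances n (IsTwoValued (m := m) a b) →
        (∀ i, (bigItems a (v i)).card = k i) → IsMMSAllocation v (t.run v)) := by
    intro k
    obtain ⟨σ, x, s, hx, hs, hxs, hxr, hv⟩ := exists_schedule hn hb hab hr (fun i => (k i).val)
      fun i => Nat.le_of_lt_succ (k i).isLt
    obtain ⟨t, ht⟩ := exists_picking_dialogue L₂ r h₂ (bigItems a) σ x hxr
    have hfin : ∀ g : Fin n → Finset (Fin m), ∃ A : Allocation n m,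
        (Pairwise fun i j => Disjoint (g i) (g j)) → (∀ i, (g i).card = x i) →
        ∀ i, g i ⊆ bundle A i ∧ s i ≤ (bundle A i).card := by
      intro g
      by_cases h : (Pairwise fun i j => Disjoint (g i) (g j)) ∧ ∀ i, (g i).card = x i
      · obtain ⟨A, hA⟩ := exists_allocation_extending hn g h.1 s
          (fun i => by rw [h.2]; exact hxs i) hs
        exact ⟨A, fun _ _ => hA⟩
      · exact ⟨fun _ => ⟨0, hn⟩, fun h1 h2 => absurd ⟨h1, h2⟩ h⟩
    choose fin hfin using hfin
    refine ⟨t.bind fun g => .done (fin g), fun v => ⟨fun i => by simp [(ht v).1],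
      fun hvc hvk => ?_⟩⟩
    obtain ⟨hp1, hp2⟩ := (ht v).2 fun i => by rw [hvk]; exact hx i
    intro i
    simp only [Dialogue.run_bind, Dialogue.run_done]
    have h1 := hfin (t.run v) hp2 (fun i => (hp1 i).2) i
    rw [(hvc i).eq_twoValue]
    refine (hv i _ (hvk i)).trans ?_
    rw [twoValue_eq]
    have h0 : 0 ≤ a - b := by linarith
    gcongr
    · exact h1.2
    · rw [← (hp1 i).2]
      exact Finset.card_le_card fun e he => Finset.mem_inter.2 ⟨(hp1 i).1 he, h1.1 he⟩
  choose cont hcont using hcont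
  refine ⟨t₁.bind cont, fun v hv => ⟨?_, fun i => ?_⟩⟩
  · rw [Dialogue.run_bind]
    refine (hcont _ v).2 hv fun i => ?_
    rw [(ht₁ v).1 i (Finset.mem_univ i), (hsend i v).1]
  · rw [Dialogue.cost_bind, (ht₁ v).2, Pi.add_apply, (hcont _ v).1]
    congr 1
    simp only [hsend]
    rw [Finset.univ_sum_single (fun _ : Fin n => L₁)]

/-- Under the weights n^(m - |T|) all subsets together weigh (n+1)^m by the binomial theorem, and
each small one weighs at least n^(m-r). -/
theorem card_small_subsets_mul_le {n m r : ℕ} (hn : 0 < n) :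
    Nat.card {T : Finset (Fin m) // T.card ≤ r} * n ^ (m - r) ≤ (n + 1) ^ m := by
  classical
  rw [Nat.card_eq_fintype_card, Fintype.card_subtype]
  have h1 : ∑ T : Finset (Fin m), n ^ (m - T.card) = (n + 1) ^ m := by
    have := Fintype.sum_pow_mul_eq_add_pow (Fin m) (1 : ℕ) n
    simpa [add_comm] using this
  rw [← h1]
  rw [← smul_eq_mul]
  refine (Finset.card_nsmul_le_sum _ (fun T => n ^ (m - T.card)) _ fun T hT => ?_).trans
    (Finset.sum_le_sum_of_subset (Finset.subset_univ _))
  exact Nat.pow_le_pow_right hn (Nat.sub_le_sub_left (by simpa using hT) m)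

theorem clog_two_le (N : ℕ) (hN : 1 ≤ N) : (Nat.clog 2 N : ℝ) ≤ Real.logb 2 N + 1 := by
  rw [← Real.natCeil_logb_natCast]
  exact (Nat.ceil_lt_add_one (Real.logb_nonneg (by norm_num) (by exact_mod_cast hN))).le

theorem twoValued_upper : ∃ c : ℝ, 0 < c ∧ ∀ n m : ℕ, 1 ≤ n → 2 * n ≤ m →
    ∀ a b : ℝ, 0 ≤ b → b < a →
      ∃ P : Protocol n m, P.SolvesMMS (instances n (IsTwoValued a b)) ∧
        ∀ v ∈ instances n (IsTwoValued (m := m) a b),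
          (P.bits v : ℝ) ≤ c * (m * Real.logb 2 n) ∧
          ∀ i, (P.agentBits v i : ℝ) ≤ c * ((m : ℝ) / n * Real.logb 2 n) := by
  refine ⟨8, by norm_num, fun n m hn hm a b hb hab => ?_⟩
  -- For one agent the bound is zero, so not a single bit may be sent.
  rcases hn.eq_or_lt with rfl | hn2
  · refine ⟨.output fun _ => 0, fun v _ => isMMSAllocation_one v _, fun v _ => ⟨?_, fun i => ?_⟩⟩
    · simp [Protocol.bits, Protocol.transcript]
    · simp [Protocol.agentBits, Protocol.transcript]
  obtain ⟨r, hr⟩ : ∃ r, r = (m + n - 1) / n := ⟨_, rfl⟩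
  have hr1 : m ≤ n * r := by
    have := Nat.lt_mul_div_succ (m + n - 1) (show 0 < n by omega)
    rw [← hr, mul_add] at this; omega
  have hr2 : n * r ≤ m + n := by
    have := Nat.mul_div_le (m + n - 1) n
    rw [← hr] at this; omega
  have hrm : r ≤ m := by
    rw [hr]
    have : 2 * m ≤ n * m := Nat.mul_le_mul_right m hn2
    exact Nat.div_le_of_le_mul (by omega)
  set N := Nat.card {T : Finset (Fin m) // T.card ≤ r} with hN
  have hNpos : 1 ≤ N := Nat.card_pos_iff.2 ⟨⟨⟨∅, by simp⟩⟩, inferInstance⟩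
  obtain ⟨t, ht⟩ := exists_twoValued_dialogue (by omega) hb hab.le hr1
    (Nat.le_pow_clog (by norm_num) (m + 1)) (Nat.le_pow_clog (by norm_num) N)
  have hn' : (2 : ℝ) ≤ n := by exact_mod_cast hn2
  have hn0 : (0 : ℝ) < n := by linarith
  have hm' : 2 * (n : ℝ) ≤ m := by exact_mod_cast hm
  have hm0 : (0 : ℝ) < m := by linarith
  obtain ⟨ρ, hρ⟩ : ∃ ρ : ℝ, ρ = m / n := ⟨_, rfl⟩
  have hmρ : (m : ℝ) = n * ρ := by rw [hρ]; field_simp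
  have hρ2 : 2 ≤ ρ := by rw [hρ, le_div_iff₀ hn0]; exact hm'
  obtain ⟨l, hl⟩ : ∃ l, l = Real.logb 2 n := ⟨_, rfl⟩
  have hl1 : 1 ≤ l := by
    rw [hl, Real.le_logb_iff_rpow_le (by norm_num) hn0]; simpa using hn'
  have hρl : ρ ≤ ρ * l := by nlinarith
  have hlρ : 2 * l ≤ ρ * l := by nlinarith
  have b1 : (Nat.clog 2 (m + 1) : ℝ) ≤ l + 2 * ρ + 2 := by
    refine (clog_two_le (m + 1) (by omega)).trans ?_
    have e1 : Real.logb 2 ((m + 1 : ℕ) : ℝ) ≤ Real.logb 2 (2 * (n * ρ)) := by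
      refine Real.logb_le_logb_of_le (by norm_num) (by positivity) ?_
      push_cast
      rw [← hmρ]; linarith
    rw [Real.logb_mul (by norm_num) (by positivity), Real.logb_mul (by positivity) (by positivity),
      ← hl, Real.logb_self_eq_one (by norm_num)] at e1
    have e2 := logb_two_le_two_mul (show 0 < ρ by linarith)
    linarith
  have b2 : (Nat.clog 2 N : ℝ) ≤ r * l + 2 * ρ + 1 := by
    refine (clog_two_le N hNpos).trans ?_
    have hN0 : (0 : ℝ) < N := by exact_mod_cast hNpos
    have e1 : (N : ℝ) * n ^ (m - r) ≤ ((n : ℝ) + 1) ^ m := by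
      exact_mod_cast card_small_subsets_mul_le (by omega)
    -- The logarithm of this is r log n plus O(m/n), because (1 + 1/n)^m ≤ e^(m/n).
    have e2 : (N : ℝ) ≤ n ^ r * (1 + 1 / n) ^ m := by
      have : ((n : ℝ) + 1) ^ m = n ^ (m - r) * (n ^ r * (1 + 1 / n) ^ m) := by
        rw [← mul_assoc, ← pow_add, Nat.sub_add_cancel hrm, ← mul_pow]
        congr 1
        field_simp
      rw [this, mul_comm] at e1
      exact le_of_mul_le_mul_left e1 (by positivity)
    have e3 := Real.logb_le_logb_of_le (b := 2) (by norm_num) hN0 e2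
    rw [Real.logb_mul (by positivity) (by positivity), Real.logb_pow, Real.logb_pow, ← hl] at e3
    have e4 : Real.logb 2 (1 + 1 / (n : ℝ)) ≤ 2 * (1 / n) := by
      have f1 := Real.log_le_sub_one_of_pos (show 0 < 1 + 1 / (n : ℝ) by positivity)
      have f2 : (1 / 2 : ℝ) < Real.log 2 := by linarith [Real.log_two_gt_d9]
      rw [Real.logb, div_le_iff₀ (by linarith)]
      have f3 : 0 < 1 / (n : ℝ) := by positivity
      nlinarith
    have e5 : (m : ℝ) * Real.logb 2 (1 + 1 / (n : ℝ)) ≤ m * (2 * (1 / n)) := by gcongr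
    have e6 : (m : ℝ) * (2 * (1 / n)) = 2 * ρ := by rw [hρ]; ring
    linarith
  have b3 : (r : ℝ) ≤ ρ + 1 := by
    have : (n : ℝ) * r ≤ m + n := by exact_mod_cast hr2
    rw [hmρ] at this
    nlinarith
  have hcost : ((Nat.clog 2 (m + 1) + Nat.clog 2 N : ℕ) : ℝ) ≤ 8 * (ρ * l) := by
    push_cast
    have : (r : ℝ) * l ≤ (ρ + 1) * l := by gcongr
    nlinarith
  refine ⟨t.toProtocol, fun v hv => ?_, fun v hv => ⟨?_, fun i => ?_⟩⟩
  · rw [Dialogue.result_toProtocol]; exact (ht v hv).1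
  · rw [Dialogue.bits_toProtocol]
    simp only [(ht v hv).2, Finset.sum_const, Finset.card_univ, Fintype.card_fin, smul_eq_mul]
    rw [Nat.cast_mul, hmρ, ← hl]
    nlinarith
  · rw [Dialogue.agentBits_toProtocol, (ht v hv).2, ← hρ, ← hl]
    exact hcost

end TwoValuedUpper

/-! ### Binary valuations: recursive halving -/

section BinaryUpper

variable {n m : ℕ}

/-- A set of items has an initial segment of every size. -/
theorem exists_cut (T : Finset (Fin m)) {c : ℕ} (hc : c ≤ T.card) :
    ∃ p : Fin (m + 1), {e ∈ T | e.val < p.val}.card = c := by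
  have key : ∀ p, c ≤ {e ∈ T | e.val < p}.card → ∃ p' ≤ p, {e ∈ T | e.val < p'}.card = c := by
    intro p
    induction p with
    | zero => exact fun h => ⟨0, le_rfl, by simpa using h.antisymm' (by simp)⟩
    | succ p ih =>
      intro h
      by_cases h' : c ≤ {e ∈ T | e.val < p}.card
      · obtain ⟨p', hp', he⟩ := ih h'
        exact ⟨p', by omega, he⟩
      · refine ⟨p + 1, le_rfl, h.antisymm' ?_⟩
        have h1 : ({e ∈ T | e.val < p + 1} : Finset (Fin m)) ⊆
            {e ∈ T | e.val < p} ∪ {e ∈ T | e.val = p} := by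
          intro e
          simp only [Finset.mem_filter, Finset.mem_union]
          rintro ⟨he, hep⟩
          rcases Nat.lt_succ_iff_lt_or_eq.1 hep with h | h
          · exact Or.inl ⟨he, h⟩
          · exact Or.inr ⟨he, h⟩
        have h2 : ({e ∈ T | e.val = p} : Finset (Fin m)).card ≤ 1 := by
          refine Finset.card_le_one.2 fun a ha b hb => Fin.ext ?_
          rw [(Finset.mem_filter.1 ha).2, (Finset.mem_filter.1 hb).2]
        have := (Finset.card_le_card h1).trans (Finset.card_union_le _ _)
        omega
  obtain ⟨p, hp, h⟩ := key m (by
    rw [Finset.filter_true_of_mem fun e _ => e.isLt]; exact hc)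
  exact ⟨⟨p, by omega⟩, h⟩

/-- Divide and choose by halving: the agents of `G` share the items of `I`. -/
theorem exists_halving_dialogue (S : ItemValuation m → Finset (Fin m)) (t : ItemValuation m → ℕ)
    {L : ℕ} (hL : m + 1 ≤ 2 ^ L) (d : ℕ) (G : Finset (Fin n)) (I : Finset (Fin m))
    (hG : G.Nonempty) (hd : G.card ≤ 2 ^ d) :
    ∃ D : Dialogue n m (Allocation n m), ∀ v, ∑ i, D.cost v i ≤ G.card * (d * L) ∧
      ((∀ i ∈ G, t (v i) * G.card ≤ (S (v i) ∩ I).card) →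
        ∀ i ∈ G, t (v i) ≤ (S (v i) ∩ I ∩ bundle (D.run v) i).card) := by
  classical
  have hsingle : ∀ (G : Finset (Fin n)) (I : Finset (Fin m)), G.card = 1 →
      ∃ D : Dialogue n m (Allocation n m), ∀ v, ∑ i, D.cost v i = 0 ∧
      ((∀ i ∈ G, t (v i) * G.card ≤ (S (v i) ∩ I).card) →
        ∀ i ∈ G, t (v i) ≤ (S (v i) ∩ I ∩ bundle (D.run v) i).card) := by
    intro G I h1
    obtain ⟨i, rfl⟩ := Finset.card_eq_one.1 h1
    refine ⟨.done fun _ => i, fun v => ⟨by simp, fun h j hj => ?_⟩⟩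
    rw [Finset.mem_singleton] at hj
    subst hj
    have : bundle (fun _ : Fin m => j) j = Finset.univ := by ext; simp
    simpa [this] using h j (by simp)
  induction d generalizing G I with
  | zero =>
    obtain ⟨D, hD⟩ := hsingle G I (le_antisymm (by simpa using hd) (Finset.card_pos.2 hG))
    exact ⟨D, fun v => ⟨by rw [(hD v).1]; exact Nat.zero_le _, (hD v).2⟩⟩
  | succ d ih =>
    have hpos := Finset.card_pos.2 hG
    rcases Nat.eq_or_lt_of_le (show 1 ≤ G.card from hpos) with h1 | h1
    · obtain ⟨D, hD⟩ := hsingle G I h1.symm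
      exact ⟨D, fun v => ⟨by rw [(hD v).1]; exact Nat.zero_le _, (hD v).2⟩⟩
    obtain ⟨g, hg⟩ : ∃ g, g = G.card / 2 := ⟨_, rfl⟩
    rw [pow_succ] at hd
    -- The cut of an agent leaves exactly the shares of g agents, by her own measure, on its left.
    choose cut hcut using fun u : ItemValuation m => show ∃ p : Fin (m + 1),
        t u * g ≤ (S u ∩ I).card → {e ∈ S u ∩ I | e.val < p.val}.card = t u * g by
      by_cases h : t u * g ≤ (S u ∩ I).card
      · obtain ⟨p, hp⟩ := exists_cut _ h
        exact ⟨p, fun _ => hp⟩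
      · exact ⟨0, fun h' => absurd h' h⟩
    choose send hsend using fun i : Fin n =>
      Dialogue.exists_send (α := Fin (m + 1)) i L (by simpa using hL) cut
    obtain ⟨D₀, hD₀⟩ := Dialogue.exists_gather send G
    have hnext : ∀ c : Fin n → Fin (m + 1), ∃ (D : Dialogue n m (Allocation n m)),
        ∀ v, ∑ i, D.cost v i ≤ G.card * (d * L) ∧ ((∀ i ∈ G, c i = cut (v i)) →
        (∀ i ∈ G, t (v i) * G.card ≤ (S (v i) ∩ I).card) →
        ∀ i ∈ G, t (v i) ≤ (S (v i) ∩ I ∩ bundle (D.run v) i).card) := by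
      intro c
      -- The order dual selects the g leftmost cuts, and the items are split at the rightmost of
      -- these. It leaves g shares on the left for each agent of `G₁`; everyone else has at most g
      -- of her shares there, hence enough on the right.
      obtain ⟨G₁, hG₁, hG₁c, htop⟩ := exists_top_subset G (fun i => OrderDual.toDual (c i))
        (k := g) (by omega)
      obtain ⟨i₁, hi₁, hmax⟩ := Finset.exists_max_image G₁ c (Finset.card_pos.1 (by omega))
      obtain ⟨p, hp⟩ : ∃ p, p = c i₁ := ⟨_, rfl⟩
      have hlow : ∀ i ∈ G \ G₁, p ≤ c i := fun i hi => by
        rw [hp]; exact OrderDual.toDual_le_toDual.1 (htop i₁ hi₁ i hi)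
      have hG₂c : (G \ G₁).card = G.card - g := by rw [Finset.card_sdiff_of_subset hG₁, hG₁c]
      obtain ⟨D₁, hD₁⟩ := ih G₁ {e ∈ I | e.val < p.val} (Finset.card_pos.1 (by omega)) (by omega)
      obtain ⟨D₂, hD₂⟩ := ih (G \ G₁) {e ∈ I | ¬ e.val < p.val} (Finset.card_pos.1 (by omega))
        (by omega)
      refine ⟨D₁.bind fun A₁ => D₂.bind fun A₂ => .done fun e => if e.val < p.val then A₁ e else A₂ e,
        fun v => ⟨?_, fun hc hshare i hi => ?_⟩⟩
      · simp only [Dialogue.cost_bind, Dialogue.cost_done, add_zero, Pi.add_apply,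
          Finset.sum_add_distrib]
        have e1 := (hD₁ v).1
        have e2 := (hD₂ v).1
        rw [hG₁c] at e1
        rw [hG₂c] at e2
        have e3 : G.card * (d * L) = g * (d * L) + (G.card - g) * (d * L) := by
          rw [← add_mul]; congr 1; omega
        omega
      · have hcutv : ∀ i ∈ G, {e ∈ S (v i) ∩ I | e.val < (c i).val}.card = t (v i) * g := by
          intro i hi
          rw [hc i hi]
          exact hcut _ ((Nat.mul_le_mul_left _ (by omega)).trans (hshare i hi))
        simp only [Dialogue.run_bind, Dialogue.run_done]
        by_cases hi₁ : i ∈ G₁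
        · refine ((hD₁ v).2 (fun j hj => ?_) i hi₁).trans (Finset.card_le_card ?_)
          · rw [hG₁c, ← hcutv j (hG₁ hj)]
            refine Finset.card_le_card fun e he => ?_
            have : (c j).val ≤ p.val := by rw [hp]; exact hmax j hj
            simp only [Finset.mem_filter, Finset.mem_inter] at he ⊢
            exact ⟨he.1.1, he.1.2, by omega⟩
          · intro e he
            simp only [Finset.mem_filter, Finset.mem_inter, mem_bundle] at he ⊢
            simp [he]
        · have hi₂ : i ∈ G \ G₁ := Finset.mem_sdiff.2 ⟨hi, hi₁⟩
          refine ((hD₂ v).2 (fun j hj => ?_) i hi₂).trans (Finset.card_le_card ?_)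
          · have hjG := (Finset.mem_sdiff.1 hj).1
            have e1 : {e ∈ S (v j) ∩ I | e.val < p.val}.card ≤ t (v j) * g := by
              rw [← hcutv j hjG]
              refine Finset.card_le_card fun e he => ?_
              have : p.val ≤ (c j).val := hlow j hj
              simp only [Finset.mem_filter] at he ⊢
              exact ⟨he.1, by omega⟩
            have e2 := Finset.card_filter_add_card_filter_not (s := S (v j) ∩ I)
              (fun e : Fin m => e.val < p.val)
            have e3 := hshare j hjG
            have e4 : S (v j) ∩ {e ∈ I | ¬ e.val < p.val} =
                {e ∈ S (v j) ∩ I | ¬ e.val < p.val} := by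
              ext e; simp [and_assoc]
            rw [e4, hG₂c]
            have e5 : t (v j) * G.card = t (v j) * g + t (v j) * (G.card - g) := by
              rw [← mul_add]; congr 1; omega
            omega
          · intro e he
            simp only [Finset.mem_filter, Finset.mem_inter, mem_bundle] at he ⊢
            simp [he]
    choose next hnext using hnext
    refine ⟨D₀.bind next, fun v => ⟨?_, fun hshare => ?_⟩⟩
    · have e1 := (hnext (D₀.run v) v).1
      simp only [Dialogue.cost_bind, Pi.add_apply, Finset.sum_add_distrib, (hD₀ v).2,
        Finset.sum_apply, hsend]
      rw [Finset.sum_comm]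
      have e2 : ∑ i ∈ G, ∑ j, (Pi.single i L : Fin n → ℕ) j = G.card * L := by simp
      rw [e2]
      have e3 : G.card * ((d + 1) * L) = G.card * L + G.card * (d * L) := by ring
      omega
    · rw [Dialogue.run_bind]
      exact (hnext _ v).2 (fun i hi => by rw [(hD₀ v).1 i hi, (hsend i v).1]) hshare

theorem mms_binary_le (hn : 1 ≤ n) (K : Finset (Fin m)) :
    mms n (twoValue 1 0 K) ≤ (K.card / n : ℕ) := by
  refine mms_le hn fun P => ?_
  by_contra! h
  have h1 : ∀ j, K.card / n + 1 ≤ (K ∩ bundle P j).card := by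
    intro j
    have := h j
    rw [twoValue_apply] at this
    have h2 : ((K.card / n : ℕ) : ℝ) < (K ∩ bundle P j).card := by linarith
    exact_mod_cast h2
  have h2 := Finset.card_nsmul_le_sum Finset.univ _ _ fun j _ => h1 j
  rw [sum_card_inter_bundle, Finset.card_univ, Fintype.card_fin, smul_eq_mul] at h2
  have := Nat.lt_mul_div_succ K.card (show 0 < n by omega)
  omega

/-- The depth of the recursion is at most ⌈log n⌉, and at each level an agent sends at most one cut,
a number up to m. -/
theorem binary_upper : ∃ c : ℝ, 0 < c ∧ ∀ n m : ℕ, 1 ≤ n → 2 * n ≤ m →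
    CCAtMost (instances n (IsBinary (m := m))) (c * (n * Real.logb 2 m * Real.logb 2 n)) := by
  refine ⟨6, by norm_num, fun n m hn hm => ?_⟩
  rcases hn.eq_or_lt with rfl | hn2
  · exact CCAtMost.one_agent _ (by simp)
  obtain ⟨D, hD⟩ := exists_halving_dialogue (n := n) (m := m) (bigItems 1)
    (fun u => (bigItems 1 u).card / n) (Nat.le_pow_clog (by norm_num) (m + 1)) (Nat.clog 2 n)
    Finset.univ Finset.univ ⟨⟨0, hn⟩, Finset.mem_univ _⟩
    (by simpa using Nat.le_pow_clog (by norm_num) n)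
  refine CCAtMost.of_dialogue D (fun v hv i => ?_) fun v _ => ?_
  · have h1 := (hD v).2 (fun i _ => by simpa using Nat.div_mul_le_self _ n) i (Finset.mem_univ i)
    rw [(isBinary_iff.1 (hv i)).eq_twoValue]
    refine (mms_binary_le hn _).trans ?_
    rw [twoValue_apply]
    simpa using h1
  · have hn' : (2 : ℝ) ≤ n := by exact_mod_cast hn2
    have hm' : (4 : ℝ) ≤ m := by exact_mod_cast (by omega : 4 ≤ m)
    have b1 : 1 ≤ Real.logb 2 (n : ℝ) := by
      rw [Real.le_logb_iff_rpow_le (by norm_num) (by linarith)]; simpa using hn'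
    have b2 : 1 ≤ Real.logb 2 (m : ℝ) := by
      rw [Real.le_logb_iff_rpow_le (by norm_num) (by linarith)]
      rw [Real.rpow_one]; linarith
    have b3 : (Nat.clog 2 n : ℝ) ≤ 2 * Real.logb 2 n := by
      have := clog_two_le n hn
      linarith
    have b4 : (Nat.clog 2 (m + 1) : ℝ) ≤ 3 * Real.logb 2 m := by
      have e1 := clog_two_le (m + 1) (by omega)
      have e2 : Real.logb 2 ((m + 1 : ℕ) : ℝ) ≤ Real.logb 2 (2 * (m : ℝ)) := by
        refine Real.logb_le_logb_of_le (by norm_num) (by positivity) ?_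
        push_cast; linarith
      rw [Real.logb_mul (by norm_num) (by positivity), Real.logb_self_eq_one (by norm_num)] at e2
      linarith
    have h1 := (hD v).1
    rw [Finset.card_univ, Fintype.card_fin] at h1
    calc ((∑ i, D.cost v i : ℕ) : ℝ) ≤ ((n * (Nat.clog 2 n * Nat.clog 2 (m + 1)) : ℕ) : ℝ) := by
          exact_mod_cast h1
      _ = n * (Nat.clog 2 n * Nat.clog 2 (m + 1)) := by push_cast; ring
      _ ≤ n * ((2 * Real.logb 2 n) * (3 * Real.logb 2 m)) := by gcongr
      _ = _ := by ring

end BinaryUpper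

/-! ### Unit demand valuations: hashing the best items -/

section UnitDemandUpper

variable {n m : ℕ}

theorem IsUnitDemand.le_of_mem {v : ItemValuation m} (hv : IsUnitDemand v) {S : Finset (Fin m)}
    {e : Fin m} (he : e ∈ S) : v {e} ≤ v S := by
  rw [hv.2.2 S ⟨e, he⟩]
  exact Finset.le_sup' (fun e => v {e}) he

/-- Each of the `n` most valuable items is worth the maximin share to a unit demand agent. -/
theorem IsUnitDemand.mms_le_of_top {v : ItemValuation m} (hv : IsUnitDemand v) (hn : 1 ≤ n)
    {T : Finset (Fin m)} (hT : T.card = n) (htop : ∀ e ∈ T, ∀ e' ∉ T, v {e'} ≤ v {e}) {e : Fin m}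
    (he : e ∈ T) : mms n v ≤ v {e} := by
  classical
  refine mms_le hn fun P => ?_
  -- The n - 1 other top items miss some bundle, whose items are then worth at most v {e}.
  obtain ⟨j, hj⟩ : ∃ j, j ∉ (T.erase e).image P := by
    by_contra! h
    have h1 : (Finset.univ : Finset (Fin n)).card ≤ ((T.erase e).image P).card :=
      Finset.card_le_card fun j _ => h j
    have h2 := Finset.card_image_le (s := T.erase e) (f := P)
    rw [Finset.card_erase_of_mem he, hT] at h2
    rw [Finset.card_univ, Fintype.card_fin] at h1
    omega
  refine ⟨j, ?_⟩
  rcases (bundle P j).eq_empty_or_nonempty with h0 | h0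
  · rw [h0, hv.2.1]; exact hv.1 e
  · rw [hv.2.2 _ h0]
    refine Finset.sup'_le _ _ fun e' he' => ?_
    by_cases hee : e' = e
    · rw [hee]
    · refine htop e he e' fun hT' => hj ?_
      rw [Finset.mem_image]
      exact ⟨e', Finset.mem_erase.2 ⟨hee, hT'⟩, by simpa using he'⟩

theorem exists_top_items (hm : n ≤ m) (v : ItemValuation m) :
    ∃ T : Finset (Fin m), T.card = n ∧ ∀ e ∈ T, ∀ e' ∉ T, v {e'} ≤ v {e} := by
  obtain ⟨T, -, hT, h⟩ := exists_top_subset Finset.univ (fun e : Fin m => v {e})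
    (k := n) (by simpa using hm)
  exact ⟨T, hT, fun e he e' he' => h e he e' (by simpa using he')⟩

open Polynomial in
/-- The polynomial whose coefficients are the last `k` binary digits of `e`. -/
noncomputable def digitPoly (F : Type) [Field F] (k e : ℕ) : F[X] :=
  ∑ t ∈ Finset.range k, if e.testBit t then X ^ t else 0

section Hash

variable {F : Type} [Field F]

theorem coeff_digitPoly (k e t : ℕ) :
    (digitPoly F k e).coeff t = if t < k ∧ e.testBit t then 1 else 0 := by
  have : ∀ x, ((if e.testBit x then (Polynomial.X : Polynomial F) ^ x else 0)).coeff t =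
      if x = t then (if e.testBit t then 1 else 0) else 0 := by
    intro x
    by_cases hx : x = t
    · subst hx; by_cases h : e.testBit x <;> simp [h]
    · by_cases h : e.testBit x
      · simp [h, hx, Polynomial.coeff_X_pow, Ne.symm hx]
      · simp [h, hx]
  simp only [digitPoly, Polynomial.finsetSum_coeff, this, Finset.sum_ite_eq', Finset.mem_range]
  by_cases h1 : t < k <;> simp [h1]

theorem digitPoly_injOn {k e e' : ℕ} (he : e < 2 ^ k) (he' : e' < 2 ^ k)
    (h : digitPoly F k e = digitPoly F k e') : e = e' := by
  refine Nat.eq_of_testBit_eq fun t => ?_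
  by_cases ht : t < k
  · have := congrArg (fun p => Polynomial.coeff p t) h
    simp only [coeff_digitPoly, ht, true_and] at this
    by_cases h1 : e.testBit t <;> by_cases h2 : e'.testBit t <;> simp_all
  · have hk : 2 ^ k ≤ 2 ^ t := Nat.pow_le_pow_right (by norm_num) (by omega)
    rw [Nat.testBit_lt_two_pow (he.trans_le hk), Nat.testBit_lt_two_pow (he'.trans_le hk)]

theorem natDegree_digitPoly_le (k e : ℕ) : (digitPoly F k e).natDegree ≤ k := by
  rw [Polynomial.natDegree_le_iff_coeff_eq_zero]
  intro t ht
  rw [coeff_digitPoly, if_neg (by omega)]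

/-- Distinct items have distinct digit polynomials of degree at most k, which agree in at most k
points. -/
theorem card_collisions_le [Fintype F] [DecidableEq F] {k e e' : ℕ} (he : e < 2 ^ k)
    (he' : e' < 2 ^ k) (hne : e ≠ e') :
    ({x | (digitPoly F k e).eval x = (digitPoly F k e').eval x} : Finset F).card ≤ k := by
  have hp : digitPoly F k e - digitPoly F k e' ≠ 0 := fun h =>
    hne (digitPoly_injOn he he' (sub_eq_zero.1 h))
  calc ({x | (digitPoly F k e).eval x = (digitPoly F k e').eval x} : Finset F).card
      ≤ (digitPoly F k e - digitPoly F k e').roots.toFinset.card := by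
        refine Finset.card_le_card fun x hx => ?_
        rw [Multiset.mem_toFinset, Polynomial.mem_roots hp, Polynomial.IsRoot, Polynomial.eval_sub,
          sub_eq_zero]
        simpa using hx
    _ ≤ (digitPoly F k e - digitPoly F k e').natDegree :=
        (Multiset.toFinset_card_le _).trans (Polynomial.card_roots' _)
    _ ≤ k := (Polynomial.natDegree_sub_le_of_le (natDegree_digitPoly_le k e)
        (natDegree_digitPoly_le k e')).trans (by simp)

/-- The points at which hashing by digit polynomials is not injective on `T`. -/
noncomputable def collisionPoints [Fintype F] [DecidableEq F] (k : ℕ) (T : Finset (Fin m)) :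
    Finset F :=
  T.offDiag.biUnion fun p => {x | (digitPoly F k p.1).eval x = (digitPoly F k p.2).eval x}

theorem card_collisionPoints_le [Fintype F] [DecidableEq F] {k : ℕ} (hk : m ≤ 2 ^ k)
    (T : Finset (Fin m)) : (collisionPoints (F := F) k T).card ≤ T.card ^ 2 * k := by
  refine (Finset.card_biUnion_le_card_mul _ _ k fun p hp => ?_).trans ?_
  · rw [Finset.mem_offDiag] at hp
    exact card_collisions_le (p.1.isLt.trans_le hk) (p.2.isLt.trans_le hk)
      fun h => hp.2.2 (Fin.ext h)
  · gcongr
    rw [Finset.offDiag_card, sq]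
    omega

theorem injOn_of_notMem_collisionPoints [Fintype F] [DecidableEq F] {k : ℕ} {T : Finset (Fin m)}
    {x : F} (hx : x ∉ collisionPoints k T) :
    Set.InjOn (fun e : Fin m => (digitPoly F k e).eval x) T := by
  intro e he e' he' h
  by_contra hne
  refine hx ?_
  rw [collisionPoints, Finset.mem_biUnion]
  exact ⟨(e, e'), Finset.mem_offDiag.2 ⟨he, he', hne⟩, by simpa using h⟩

end Hash

/-- If bad options are rare on average, the agents find an option that is good for all of them by
bisection, with a rough report on the bad options in each half. -/
theorem exists_selection_dialogue (hn : 1 ≤ n) {ι : Type} [DecidableEq ι]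
    (bad : ItemValuation m → Finset ι) (L : ℕ) (H : Finset ι) (W : ℝ) (hH : H.card = 2 ^ L)
    (hW : 0 < W) (hWL : W * (5 / 8) ^ L < 1) :
    ∃ D : Dialogue n m ι, ∀ v, (∑ i, ((bad (v i) ∩ H).card : ℝ)) ≤ W →
      (∀ i, D.run v ∉ bad (v i)) ∧ ∑ i, D.cost v i ≤ 9 * n * L := by
  induction L generalizing H W with
  | zero =>
    obtain ⟨x, rfl⟩ := Finset.card_eq_one.1 (by simpa using hH)
    refine ⟨.done x, fun v hv => ⟨fun i hi => ?_, by simp⟩⟩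
    have h1 : ((bad (v i) ∩ {x}).card : ℝ) ≤ W :=
      (Finset.single_le_sum (f := fun i => ((bad (v i) ∩ {x}).card : ℝ))
        (fun _ _ => Nat.cast_nonneg _) (Finset.mem_univ i)).trans hv
    have h2 : bad (v i) ∩ {x} = {x} := Finset.inter_eq_right.2 (by simpa using hi)
    rw [h2] at h1
    simp at h1 hWL
    linarith
  | succ L ih =>
    have hn' : (0 : ℝ) < n := by exact_mod_cast hn
    obtain ⟨H₀, hH₀, hH₀c⟩ := Finset.exists_subset_card_eq (s := H) (n := 2 ^ L)
      (by rw [hH, pow_succ]; omega)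
    have hH₁c : (H \ H₀).card = 2 ^ L := by
      rw [Finset.card_sdiff_of_subset hH₀, hH, hH₀c, pow_succ]; omega
    have hW' : W * (5 / 8) * (5 / 8) ^ L < 1 := by rw [pow_succ] at hWL; linarith
    obtain ⟨D₀, hD₀⟩ := ih H₀ (W * (5 / 8)) hH₀c (by positivity) hW'
    obtain ⟨D₁, hD₁⟩ := ih (H \ H₀) (W * (5 / 8)) hH₁c (by positivity) hW'
    -- In units of W/(8n) the reports sum to at most 8n, so unary coding costs at most 9n bits per
    -- level in total, however unevenly the bad options are spread.
    obtain ⟨q, hq⟩ : ∃ q : ItemValuation m → ℕ,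
        ∀ u, q u = ⌊8 * n * ((bad u ∩ H₀).card : ℝ) / W⌋₊ := ⟨_, fun _ => rfl⟩
    obtain ⟨R, hR⟩ := Dialogue.exists_gather
      (fun i : Fin n => Dialogue.sendUnary i (8 * n) q) Finset.univ
    -- Rounding loses at most n units. A sum up to 4n therefore leaves at most 5n units, or 5W/8, in
    -- `H₀`; a larger sum means at least W/2 there and at most W/2 in the other half.
    refine ⟨R.bind fun g => if ∑ i, g i ≤ 4 * n then D₀ else D₁, fun v hv => ?_⟩
    have hsplit : ∀ i, ((bad (v i) ∩ H).card : ℝ) =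
        (bad (v i) ∩ H₀).card + (bad (v i) ∩ (H \ H₀)).card := by
      intro i
      rw [← Nat.cast_add, ← Finset.card_union_of_disjoint, ← Finset.inter_union_distrib_left,
        Finset.union_sdiff_of_subset hH₀]
      exact Finset.disjoint_of_subset_left Finset.inter_subset_right
        (Finset.disjoint_of_subset_right Finset.inter_subset_right Finset.disjoint_sdiff)
    simp only [hsplit, Finset.sum_add_distrib] at hv
    obtain ⟨c₀, hc₀⟩ : ∃ c₀, c₀ = ∑ i, ((bad (v i) ∩ H₀).card : ℝ) := ⟨_, rfl⟩
    obtain ⟨c₁, hc₁⟩ : ∃ c₁, c₁ = ∑ i, ((bad (v i) ∩ (H \ H₀)).card : ℝ) := ⟨_, rfl⟩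
    rw [← hc₀, ← hc₁] at hv
    have hc₁0 : 0 ≤ c₁ := hc₁ ▸ Finset.sum_nonneg fun _ _ => Nat.cast_nonneg _
    have hqle : ∀ i, (q (v i) : ℝ) ≤ 8 * n * ((bad (v i) ∩ H₀).card : ℝ) / W := fun i => by
      rw [hq]; exact Nat.floor_le (by positivity)
    have hqlt : ∀ i, 8 * n * ((bad (v i) ∩ H₀).card : ℝ) / W ≤ q (v i) + 1 := fun i => by
      rw [hq]; exact (Nat.lt_floor_add_one _).le
    have hsumle : ((∑ i, q (v i) : ℕ) : ℝ) ≤ 8 * n * c₀ / W := by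
      rw [Nat.cast_sum, hc₀, Finset.mul_sum, Finset.sum_div]
      exact Finset.sum_le_sum fun i _ => hqle i
    have hsumlt : 8 * n * c₀ / W ≤ ((∑ i, q (v i) : ℕ) : ℝ) + n := by
      rw [Nat.cast_sum, hc₀, Finset.mul_sum, Finset.sum_div]
      refine (Finset.sum_le_sum fun i _ => hqlt i).trans ?_
      rw [Finset.sum_add_distrib]; simp
    rw [le_div_iff₀ hW] at hsumle
    rw [div_le_iff₀ hW] at hsumlt
    have hq8 : ∑ i, q (v i) ≤ 8 * n := by
      have : ((∑ i, q (v i) : ℕ) : ℝ) * W ≤ (8 * n) * W := by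
        refine hsumle.trans ?_
        gcongr
        linarith
      exact_mod_cast le_of_mul_le_mul_right this hW
    have hrun : ∑ i, R.run v i = ∑ i, q (v i) := by
      refine Finset.sum_congr rfl fun i _ => ?_
      rw [(hR v).1 i (Finset.mem_univ i), Dialogue.run_sendUnary]
      exact (Finset.single_le_sum (f := fun i => q (v i)) (fun _ _ => Nat.zero_le _)
        (Finset.mem_univ i)).trans hq8
    have hcost : ∑ i, R.cost v i ≤ 9 * n := by
      calc ∑ i, R.cost v i = ∑ j, ∑ i, (Dialogue.sendUnary j (8 * n) q).cost v i := by
            rw [(hR v).2, Finset.sum_comm]; simp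
        _ ≤ ∑ j, ∑ i, (Pi.single j (q (v j) + 1) : Fin n → ℕ) i :=
            Finset.sum_le_sum fun j _ => Finset.sum_le_sum fun i _ =>
              Dialogue.cost_sendUnary j (8 * n) q v i
        _ = ∑ j, q (v j) + n := by simp [Finset.sum_add_distrib]
        _ ≤ _ := by omega
    simp only [Dialogue.run_bind, Dialogue.cost_bind, Pi.add_apply, Finset.sum_add_distrib, hrun]
    split_ifs with hle
    · have hle' : ((∑ i, q (v i) : ℕ) : ℝ) ≤ 4 * n := by exact_mod_cast hle
      obtain ⟨h1, h2⟩ := hD₀ v (by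
        rw [← hc₀]
        have : n * c₀ ≤ n * (W * (5 / 8)) := by nlinarith
        exact le_of_mul_le_mul_left this hn')
      exact ⟨h1, by rw [mul_add, mul_one]; omega⟩
    · have hgt : 4 * (n : ℝ) ≤ ((∑ i, q (v i) : ℕ) : ℝ) := by
        exact_mod_cast (not_le.1 hle).le
      obtain ⟨h1, h2⟩ := hD₁ v (by
        rw [← hc₁]
        have h3 : n * (W / 2) ≤ n * c₀ := by nlinarith
        have h4 := le_of_mul_le_mul_left h3 hn'
        linarith)
      exact ⟨h1, by rw [mul_add, mul_one]; omega⟩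

/-- The hash of an item is its digit polynomial evaluated at a point of a field with 2^L elements.
Each agent rules out at most n^2 k points, together n^3 k, so bisection finds a point good for all.
Each agent then claims one hash value of her top items and receives all items with this value. -/
theorem exists_unitDemand_dialogue (hn : 1 ≤ n) (hm : n ≤ m) {k L : ℕ} (hL : 1 ≤ L)
    (hk : m ≤ 2 ^ k) (hk0 : 1 ≤ k) (hW : (n ^ 3 * k : ℝ) * (5 / 8) ^ L < 1) :
    ∃ D : Dialogue n m (Allocation n m), ∀ v ∈ instances n (IsUnitDemand (m := m)),
      IsMMSAllocation v (D.run v) ∧ ∑ i, D.cost v i ≤ 9 * n * L + n * (L + 1) := by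
  classical
  let F := GaloisField 2 L
  have hF : Nat.card F = 2 ^ L := GaloisField.card 2 L (by omega)
  have : Finite F := Nat.finite_of_card_ne_zero (by rw [hF]; positivity)
  have : Fintype F := Fintype.ofFinite F
  choose T hT htop using exists_top_items (n := n) hm
  have hn' : (0 : ℝ) < n := by exact_mod_cast hn
  have hk' : (0 : ℝ) < k := by exact_mod_cast hk0
  obtain ⟨D₁, hD₁⟩ := exists_selection_dialogue hn (fun u => collisionPoints (F := F) k (T u)) L
    Finset.univ (n ^ 3 * k) (by rw [Finset.card_univ, ← Nat.card_eq_fintype_card, hF])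
    (by positivity) hW
  have hsmall : Nat.card {S : Finset F // S.card ≤ 1} ≤ 2 ^ (L + 1) := by
    let f : Option F → {S : Finset F // S.card ≤ 1} := fun o =>
      ⟨o.toFinset, by cases o <;> simp⟩
    have hf : Function.Surjective f := by
      rintro ⟨S, hS⟩
      rcases Nat.le_one_iff_eq_zero_or_eq_one.1 hS with h | h
      · exact ⟨none, Subtype.ext (Finset.card_eq_zero.1 h).symm⟩
      · obtain ⟨a, rfl⟩ := Finset.card_eq_one.1 h
        exact ⟨some a, rfl⟩
    refine (Nat.card_le_card_of_surjective f hf).trans ?_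
    rw [Finite.card_option, hF, pow_succ]
    have := Nat.one_le_two_pow (n := L)
    omega
  -- With n distinct values per agent and one value taken per turn, any order works; the identity is
  -- used.
  choose D₂ hD₂ using fun x : F => exists_picking_dialogue (n := n) (L + 1) 1 hsmall
    (fun u : ItemValuation m => (T u).image fun e : Fin m => (digitPoly F k e).eval x) 1 (fun _ => 1)
    (fun _ => le_rfl)
  let out : F → (Fin n → Finset F) → Allocation n m := fun x g e =>
    if h : ∃ i, (digitPoly F k e).eval x ∈ g i then h.choose else ⟨0, hn⟩
  refine ⟨D₁.bind fun x => (D₂ x).bind fun g => .done (out x g), fun v hv => ?_⟩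
  obtain ⟨h1, h2⟩ := hD₁ v (by
    have : ∀ i, ((collisionPoints (F := F) k (T (v i)) ∩ Finset.univ).card : ℝ) ≤ n ^ 2 * k := by
      intro i
      rw [Finset.inter_univ, ← hT (v i)]
      exact_mod_cast card_collisionPoints_le hk (T (v i))
    refine (Finset.sum_le_sum fun i _ => this i).trans (le_of_eq ?_)
    simp; ring)
  set x := D₁.run v with hx
  constructor
  · have hinj := fun i => injOn_of_notMem_collisionPoints (h1 i)
    obtain ⟨h3, h4⟩ := (hD₂ x v).2 fun i => by
      rw [Finset.card_image_of_injOn (hinj _), hT, ← Finset.card_filter]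
      exact (Finset.card_le_univ _).trans (by simp)
    intro i
    simp only [Dialogue.run_bind, Dialogue.run_done, ← hx]
    set g := (D₂ x).run v
    obtain ⟨c, hc⟩ := Finset.card_eq_one.1 (h3 i).2
    have hcg : c ∈ g i := by rw [hc]; simp
    obtain ⟨e, heT, hec⟩ := Finset.mem_image.1 ((h3 i).1 hcg)
    refine ((hv i).mms_le_of_top hn (hT _) (htop _) heT).trans ((hv i).le_of_mem ?_)
    rw [mem_bundle]
    have hex : ∃ j, (digitPoly F k e).eval x ∈ g j := ⟨i, by rw [hec]; exact hcg⟩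
    simp only [out, hex, dif_pos]
    by_contra hne
    refine Finset.disjoint_left.1 (h4 hne) hex.choose_spec ?_
    rw [hec]; exact hcg
  · simp only [Dialogue.cost_bind, Dialogue.cost_done, add_zero, Pi.add_apply,
      Finset.sum_add_distrib, ← hx, (hD₂ x v).1]
    simp only [Finset.sum_const, Finset.card_univ, Fintype.card_fin, smul_eq_mul, ← mul_add]
    exact Nat.add_le_add_right h2 _

theorem logb_clog_le (hm : 2 ≤ m) :
    Real.logb 2 (Nat.clog 2 m) ≤ 1 + Real.logb 2 (Real.logb 2 m) := by
  have hm' : (2 : ℝ) ≤ m := by exact_mod_cast hm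
  have h1 : 1 ≤ Real.logb 2 (m : ℝ) := by
    rw [Real.le_logb_iff_rpow_le (by norm_num) (by linarith)]; simpa using hm'
  have h2 := clog_two_le m (by omega)
  have h3 : (0 : ℝ) < Nat.clog 2 m := by exact_mod_cast Nat.clog_pos (by norm_num) hm
  have h4 : Real.logb 2 (Nat.clog 2 m) ≤ Real.logb 2 (2 * Real.logb 2 m) :=
    Real.logb_le_logb_of_le (by norm_num) h3 (by linarith)
  rwa [Real.logb_mul (by norm_num) (by linarith), Real.logb_self_eq_one (by norm_num)] at h4

theorem unitDemand_upper : ∃ c : ℝ, 0 < c ∧ ∀ n m : ℕ, 1 ≤ n → 2 * n ≤ m →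
    CCAtMost (instances n (IsUnitDemand (m := m)))
      (c * (n * (Real.logb 2 n + Real.logb 2 (Real.logb 2 ((m : ℝ) / n))))) := by
  refine ⟨400, by norm_num, fun n m hn hm => ?_⟩
  have hn0 : (0 : ℝ) < n := by exact_mod_cast hn
  have hm0 : (0 : ℝ) < m := by exact_mod_cast (by omega : 0 < m)
  have hρ : 2 ≤ (m : ℝ) / n := by rw [le_div_iff₀ hn0]; exact_mod_cast hm
  obtain ⟨w, hw⟩ : ∃ w, w = Real.logb 2 ((m : ℝ) / n) := ⟨_, rfl⟩
  have hw1 : 1 ≤ w := by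
    rw [hw, Real.le_logb_iff_rpow_le (by norm_num) (by linarith)]; simpa using hρ
  have hω : 0 ≤ Real.logb 2 w := Real.logb_nonneg (by norm_num) hw1
  rw [← hw]
  rcases hn.eq_or_lt with rfl | hn2
  · exact CCAtMost.one_agent _ (by simpa using hω)
  obtain ⟨k, hk⟩ : ∃ k, k = Nat.clog 2 m := ⟨_, rfl⟩
  have hk1 : 1 ≤ k := hk ▸ Nat.clog_pos (by norm_num) (by omega)
  obtain ⟨j, hj⟩ : ∃ j, j = Nat.clog 2 (n ^ 3 * k + 1) := ⟨_, rfl⟩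
  have hnk : 1 ≤ n ^ 3 * k := Nat.mul_pos (by positivity) hk1
  have hj1 : 1 ≤ j := hj ▸ Nat.clog_pos (by norm_num) (by omega)
  have hj2 : n ^ 3 * k + 1 ≤ 2 ^ j := hj ▸ Nat.le_pow_clog (by norm_num) _
  -- The factor 3 is chosen for (5/8)^3 ≤ 1/2, while 2^j exceeds n^3 k.
  obtain ⟨D, hD⟩ := exists_unitDemand_dialogue hn (by omega) (L := 3 * j) (by omega)
    (hk ▸ Nat.le_pow_clog (by norm_num) m) hk1 (by
      have h1 : (n ^ 3 * k : ℝ) + 1 ≤ 2 ^ j := by exact_mod_cast hj2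
      have h2 : ((5 : ℝ) / 8) ^ (3 * j) ≤ (1 / 2) ^ j := by
        rw [pow_mul]; gcongr; norm_num
      calc (n ^ 3 * k : ℝ) * (5 / 8) ^ (3 * j) ≤ n ^ 3 * k * (1 / 2) ^ j := by gcongr
        _ < 2 ^ j * (1 / 2) ^ j := by gcongr; linarith
        _ = 1 := by rw [← mul_pow]; norm_num)
  refine CCAtMost.of_dialogue D (fun v hv => (hD v hv).1) fun v hv => ?_
  have hn' : (2 : ℝ) ≤ n := by exact_mod_cast hn2
  obtain ⟨l, hl⟩ : ∃ l, l = Real.logb 2 n := ⟨_, rfl⟩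
  have hl1 : 1 ≤ l := by
    rw [hl, Real.le_logb_iff_rpow_le (by norm_num) hn0]; simpa using hn'
  rw [← hl]
  have hlm : Real.logb 2 m = l + w := by
    rw [hl, hw, ← Real.logb_mul hn0.ne' (by positivity)]
    congr 1; field_simp
  have b1 : Real.logb 2 (Real.logb 2 m) ≤ 1 + 2 * l + Real.logb 2 w := by
    have e1 : Real.logb 2 (Real.logb 2 m) ≤ Real.logb 2 (2 * (l * w)) := by
      refine Real.logb_le_logb_of_le (by norm_num) (by linarith) ?_
      rw [hlm]; nlinarith
    rw [Real.logb_mul (by norm_num) (by positivity), Real.logb_mul (by positivity) (by positivity),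
      Real.logb_self_eq_one (by norm_num)] at e1
    have := logb_two_le_two_mul (show 0 < l by linarith)
    linarith
  have b2 : (j : ℝ) ≤ 4 + 5 * l + Real.logb 2 w := by
    have hk0 : (0 : ℝ) < k := by exact_mod_cast hk1
    have e1 := clog_two_le (n ^ 3 * k + 1) (by omega)
    rw [← hj] at e1
    have e2 : Real.logb 2 ((n ^ 3 * k + 1 : ℕ) : ℝ) ≤ Real.logb 2 (2 * ((n : ℝ) ^ 3 * k)) := by
      refine Real.logb_le_logb_of_le (by norm_num) (by positivity) ?_
      have : (1 : ℝ) ≤ n ^ 3 * k := by exact_mod_cast hnk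
      push_cast; linarith
    rw [Real.logb_mul (by norm_num) (by positivity), Real.logb_mul (by positivity) (by positivity),
      Real.logb_pow, Real.logb_self_eq_one (by norm_num), ← hl] at e2
    have e3 := logb_clog_le (m := m) (by omega)
    rw [← hk] at e3
    push_cast at e2 ⊢
    push_cast at e1
    linarith
  have h1 := (hD v hv).2
  calc ((∑ i, D.cost v i : ℕ) : ℝ) ≤ ((9 * n * (3 * j) + n * (3 * j + 1) : ℕ) : ℝ) := by
        exact_mod_cast h1
    _ = n * (30 * j + 1) := by push_cast; ring
    _ ≤ n * (400 * (l + Real.logb 2 w)) := by gcongr; linarith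
    _ = _ := by ring

/-- Repeated averaging: if every `x` is served by a `1 / Q` fraction of the `y`, then few `y`
serve all `x`. -/
theorem exists_cover {X Y : Type*} [Fintype Y] [Nonempty Y] (good : X → Y → Prop) {Q : ℝ}
    (hQ : 0 < Q) [∀ x y, Decidable (good x y)]
    (h : ∀ x, (Fintype.card Y : ℝ) ≤ Q * ({y | good x y} : Finset Y).card) (N : ℕ) (R : Finset X)
    (hR : R.card * (1 - 1 / Q) ^ N < 1) : ∃ c : Fin N → Y, ∀ x ∈ R, ∃ i, good x (c i) := by
  classical
  induction N generalizing R with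
  | zero =>
    have : R.card = 0 := by
      by_contra hne
      have : (1 : ℝ) ≤ R.card := by exact_mod_cast Nat.pos_of_ne_zero hne
      rw [pow_zero, mul_one] at hR; linarith
    rw [Finset.card_eq_zero] at this
    exact ⟨Fin.elim0, by simp [this]⟩
  | succ N ih =>
    -- By double counting, some y serves at least the average number of elements of R, a 1/Q
    -- fraction.
    obtain ⟨y, hy⟩ : ∃ y, (R.card : ℝ) ≤ Q * {x ∈ R | good x y}.card := by
      by_contra! hcon
      have h1 : ∑ y : Y, Q * (({x ∈ R | good x y} : Finset X).card : ℝ) < ∑ _y : Y, (R.card : ℝ) :=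
        Finset.sum_lt_sum_of_nonempty Finset.univ_nonempty fun y _ => hcon y
      have h2 : ∑ y : Y, Q * (({x ∈ R | good x y} : Finset X).card : ℝ) =
          ∑ x ∈ R, Q * (({y | good x y} : Finset Y).card : ℝ) := by
        rw [← Finset.mul_sum, ← Finset.mul_sum]
        congr 1
        simp only [Finset.card_filter, Nat.cast_sum]
        rw [Finset.sum_comm]
      have h3 : ∑ _x ∈ R, (Fintype.card Y : ℝ) ≤
          ∑ x ∈ R, Q * (({y | good x y} : Finset Y).card : ℝ) := Finset.sum_le_sum fun x _ => h x
      rw [h2] at h1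
      simp only [Finset.sum_const, nsmul_eq_mul, Finset.card_univ] at h1 h3
      linarith
    have hcard : (({x ∈ R | ¬ good x y} : Finset X).card : ℝ) ≤ R.card * (1 - 1 / Q) := by
      have h1 := Finset.card_filter_add_card_filter_not (s := R) (fun x => good x y)
      have h2 : (({x ∈ R | good x y} : Finset X).card : ℝ) +
          ({x ∈ R | ¬ good x y} : Finset X).card = R.card := by exact_mod_cast h1
      have h3 : (R.card : ℝ) * (1 / Q) ≤ ({x ∈ R | good x y} : Finset X).card := by
        rw [mul_one_div, div_le_iff₀ hQ, mul_comm]; exact hy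
      linarith
    have hQ1 : R.Nonempty → 0 ≤ 1 - 1 / Q := by
      rintro ⟨x, -⟩
      have h1 : (({y | good x y} : Finset Y).card : ℝ) ≤ Fintype.card Y := by
        exact_mod_cast Finset.card_le_univ _
      have h2 : (0 : ℝ) < Fintype.card Y := by exact_mod_cast Fintype.card_pos
      have h3 : 1 ≤ Q := by
        by_contra! hlt
        have := h x
        nlinarith
      have : 1 / Q ≤ 1 := by rw [div_le_one hQ]; exact h3
      linarith
    rcases R.eq_empty_or_nonempty with rfl | hne
    · exact ⟨fun _ => y, by simp⟩
    obtain ⟨c, hc⟩ := ih {x ∈ R | ¬ good x y} (by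
      refine lt_of_le_of_lt ?_ hR
      rw [pow_succ', ← mul_assoc]
      have := hQ1 hne
      gcongr)
    refine ⟨Fin.cons y c, fun x hx => ?_⟩
    by_cases hg : good x y
    · exact ⟨0, by simpa using hg⟩
    · obtain ⟨i, hi⟩ := hc x (Finset.mem_filter.2 ⟨hx, hg⟩)
      exact ⟨i.succ, by simpa using hi⟩

/-- The term n^n / n! of the exponential series is at most e^n, and e < 4. -/
theorem pow_self_le_four_pow_mul_factorial (n : ℕ) : (n : ℝ) ^ n ≤ 4 ^ n * n.factorial := by
  have h1 := Real.pow_div_factorial_le_exp (x := n) (by positivity) n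
  rw [div_le_iff₀ (by positivity)] at h1
  refine h1.trans ?_
  gcongr
  rw [← Real.exp_one_pow]
  gcongr
  linarith [Real.exp_one_lt_three]

/-- A random map to `n` colours is injective on a given `n`-set with probability `4 ^ (-n)`. -/
theorem card_functions_le_mul_card_injOn {T : Finset (Fin m)} (hT : T.card = n) :
    (Fintype.card (Allocation n m) : ℝ) ≤
      4 ^ n * ({A | Set.InjOn A T} : Set (Allocation n m)).ncard := by
  classical
  have hle : n ≤ m := by rw [← hT]; simpa using Finset.card_le_univ T
  -- A bijection on T and an arbitrary map off T yield n! n^(m-n) allocations injective on T.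
  let f : (T ≃ Fin n) × ({e : Fin m // e ∉ T} → Fin n) → Allocation n m :=
    fun p e => if h : e ∈ T then p.1 ⟨e, h⟩ else p.2 ⟨e, h⟩
  have hf : Function.Injective f := by
    rintro ⟨p, q⟩ ⟨p', q'⟩ h
    refine Prod.ext (Equiv.ext fun e => ?_) (funext fun e => ?_)
    · have := congrFun h e.1
      simpa [f] using this
    · have := congrFun h e.1
      simpa [f, e.2] using this
  have hsub : Set.range f ⊆ {A | Set.InjOn A T} := by
    rintro _ ⟨⟨p, q⟩, rfl⟩ e he e' he' h
    have he1 : e ∈ T := he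
    have he2 : e' ∈ T := he'
    simp only [f, he1, he2, dif_pos] at h
    simpa using p.injective h
  have h1 : n.factorial * n ^ (m - n) ≤ ({A | Set.InjOn A T} : Set (Allocation n m)).ncard := by
    refine le_trans (le_of_eq ?_) (Set.ncard_le_ncard hsub (Set.toFinite _))
    rw [← Set.image_univ, Set.ncard_image_of_injective _ hf, Set.ncard_univ, Nat.card_prod]
    congr 1
    · rw [Nat.card_eq_fintype_card, Fintype.card_equiv (T.equivFinOfCardEq hT)]
      simp [hT]
    · simp [hT, Fintype.card_subtype_compl]
  have h2 : (n.factorial * n ^ (m - n) : ℝ) ≤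
      ({A | Set.InjOn A T} : Set (Allocation n m)).ncard := by exact_mod_cast h1
  have h3 : (Fintype.card (Allocation n m) : ℝ) = n ^ n * n ^ (m - n) := by
    rw [← pow_add, Nat.add_sub_cancel' hle]; simp
  rw [h3]
  calc (n : ℝ) ^ n * n ^ (m - n) ≤ (4 ^ n * n.factorial) * n ^ (m - n) := by
        gcongr; exact pow_self_le_four_pow_mul_factorial n
    _ = 4 ^ n * (n.factorial * n ^ (m - n)) := by ring
    _ ≤ _ := by gcongr

/-- There are at most 2^(nk) sets of size n. Every 4^n greedily chosen colourings at least halve the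
bound on the number not yet served, since (1 - 1/Q)^Q ≤ 1/e ≤ 1/2, so n k + 1 such rounds leave
none. -/
theorem exists_perfect_hash_family (hn : 1 ≤ n) {k : ℕ} (hk : m ≤ 2 ^ k) :
    ∃ c : Fin (4 ^ n * (n * k + 1)) → Allocation n m,
      ∀ T : Finset (Fin m), T.card = n → ∃ i, Set.InjOn (c i) T := by
  classical
  have : Nonempty (Allocation n m) := ⟨fun _ => ⟨0, hn⟩⟩
  obtain ⟨c, hc⟩ := exists_cover (X := {T : Finset (Fin m) // T.card = n})
    (fun T (A : Allocation n m) => Set.InjOn A T.1) (Q := 4 ^ n) (by positivity) (fun T => by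
      convert card_functions_le_mul_card_injOn T.2
      rw [Set.ncard_eq_toFinset_card']
      simp) (4 ^ n * (n * k + 1)) Finset.univ (by
      have h1 : (Finset.univ : Finset {T : Finset (Fin m) // T.card = n}).card ≤ 2 ^ (n * k) := by
        rw [Finset.card_univ, Fintype.card_finset_len, Fintype.card_fin]
        refine (Nat.choose_le_pow m n).trans ?_
        rw [mul_comm n k, pow_mul]
        exact Nat.pow_le_pow_left hk n
      have h2 : (1 - 1 / (4 : ℝ) ^ n) ^ (4 ^ n) ≤ 1 / 2 := by
        have e1 := Real.one_sub_div_pow_le_exp_neg (n := 4 ^ n) (t := 1)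
          (by exact_mod_cast Nat.one_le_pow n 4 (by norm_num))
        push_cast at e1
        refine e1.trans ?_
        have := Real.exp_neg_one_lt_d9
        linarith
      have h0 : (0 : ℝ) ≤ 1 - 1 / 4 ^ n := by
        have : (1 : ℝ) / 4 ^ n ≤ 1 := by
          rw [div_le_one (by positivity)]
          exact one_le_pow₀ (by norm_num)
        linarith
      rw [pow_mul]
      calc ((Finset.univ : Finset {T : Finset (Fin m) // T.card = n}).card : ℝ) *
            ((1 - 1 / (4 : ℝ) ^ n) ^ (4 ^ n)) ^ (n * k + 1)
          ≤ 2 ^ (n * k) * (1 / 2) ^ (n * k + 1) := by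
            gcongr
            exact_mod_cast h1
        _ = 1 / 2 := by rw [pow_succ, ← mul_assoc, ← mul_pow]; norm_num
        _ < 1 := by norm_num)
  exact ⟨c, fun T hT => hc ⟨T, hT⟩ (Finset.mem_univ _)⟩

/-- An allocation injective on the n best items gives each agent one of them. Its index in the
family takes 2n + log(nk + 1) bits up to rounding, with k about log m. -/
theorem identical_unitDemand_upper : ∃ c : ℝ, 0 < c ∧ ∀ n m : ℕ, 1 ≤ n → 2 * n ≤ m →
    CCAtMost (identicalInstances n (IsUnitDemand (m := m)))
      (c * (n + Real.logb 2 (Real.logb 2 m))) := by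
  refine ⟨9, by norm_num, fun n m hn hm => ?_⟩
  classical
  obtain ⟨k, hk⟩ : ∃ k, k = Nat.clog 2 m := ⟨_, rfl⟩
  have hk1 : 1 ≤ k := hk ▸ Nat.clog_pos (by norm_num) (by omega)
  obtain ⟨N, hN, c, hc⟩ : ∃ N, N = 4 ^ n * (n * k + 1) ∧ ∃ c : Fin N → Allocation n m,
      ∀ T : Finset (Fin m), T.card = n → ∃ i, Set.InjOn (c i) T :=
    ⟨_, rfl, exists_perfect_hash_family hn (hk ▸ Nat.le_pow_clog (by norm_num) m)⟩
  choose T hT htop using exists_top_items (n := n) (m := m) (by omega)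
  choose ix hix using hc
  have hN1 : 1 ≤ N := hN ▸ Nat.mul_pos (by positivity) (by omega)
  obtain ⟨t, ht⟩ := Dialogue.exists_send (α := Fin N) (n := n) (m := m) ⟨0, hn⟩ (Nat.clog 2 N)
    (by simpa using Nat.le_pow_clog (by norm_num) N) fun u => ix (T u) (hT u)
  refine CCAtMost.of_dialogue (t.bind fun i => .done (c i)) ?_ ?_
  · rintro v ⟨u, hu, hv⟩ i
    simp only [Dialogue.run_bind, (ht v).1, Dialogue.run_done, hv]
    have hinj := hix (T u) (hT u)
    set A := c (ix (T u) (hT u))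
    have himg : (T u).image A = Finset.univ := by
      refine Finset.eq_univ_of_card _ ?_
      rw [Finset.card_image_of_injOn hinj, hT, Fintype.card_fin]
    obtain ⟨e, he, hei⟩ := Finset.mem_image.1 (himg ▸ Finset.mem_univ i)
    exact (hu.mms_le_of_top hn (hT u) (htop u) he).trans (hu.le_of_mem (by simpa using hei))
  · rintro v -
    simp only [Dialogue.cost_bind, (ht v).2, Dialogue.cost_done, add_zero]
    rw [Finset.sum_pi_single']
    simp only [Finset.mem_univ, if_true]
    have hn' : (1 : ℝ) ≤ n := by exact_mod_cast hn
    have hk' : (1 : ℝ) ≤ k := by exact_mod_cast hk1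
    have hm' : (2 : ℝ) ≤ m := by exact_mod_cast (by omega : 2 ≤ m)
    have hlm : 1 ≤ Real.logb 2 (m : ℝ) := by
      rw [Real.le_logb_iff_rpow_le (by norm_num) (by linarith)]; simpa using hm'
    have hllm : 0 ≤ Real.logb 2 (Real.logb 2 (m : ℝ)) := Real.logb_nonneg (by norm_num) hlm
    have e1 := clog_two_le N hN1
    have e2 : Real.logb 2 (N : ℝ) ≤ Real.logb 2 (2 ^ (2 * n) * (2 * (n * k))) := by
      refine Real.logb_le_logb_of_le (by norm_num) (by exact_mod_cast hN1) ?_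
      rw [hN]
      push_cast
      rw [pow_mul]
      have : (1 : ℝ) ≤ n * k := by nlinarith
      norm_num
      linarith
    rw [Real.logb_mul (by positivity) (by positivity), Real.logb_mul (by positivity) (by positivity),
      Real.logb_mul (by positivity) (by positivity), Real.logb_pow,
      Real.logb_self_eq_one (by norm_num)] at e2
    have e3 := logb_clog_le (m := m) (by omega)
    rw [← hk] at e3
    have e4 := logb_two_le_two_mul (show (0 : ℝ) < n by linarith)
    push_cast at e2
    linarith

end UnitDemandUpper

/-! ### The combined theorem -/

theorem theorem2 :
    -- unit demand valuations
    (∃ c : ℝ, 0 < c ∧ ∀ n m : ℕ, 1 ≤ n → 2 * n ≤ m →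
      CCAtMost (instances n (IsUnitDemand (m := m)))
        (c * (n * (Real.logb 2 n + Real.logb 2 (Real.logb 2 ((m : ℝ) / n)))))) ∧
    -- binary additive valuations
    (∃ c : ℝ, 0 < c ∧ ∀ n m : ℕ, 1 ≤ n → 2 * n ≤ m →
      CCAtMost (instances n (IsBinary (m := m)))
        (c * (n * Real.logb 2 m * Real.logb 2 n))) ∧
    -- 2-valued additive valuations, in total and for each agent
    (∃ c : ℝ, 0 < c ∧ ∀ n m : ℕ, 1 ≤ n → 2 * n ≤ m → ∀ a b : ℝ, 0 ≤ b → b < a →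
      ∃ P : Protocol n m, P.SolvesMMS (instances n (IsTwoValued a b)) ∧
        ∀ v ∈ instances n (IsTwoValued (m := m) a b),
          (P.bits v : ℝ) ≤ c * (m * Real.logb 2 n) ∧
          ∀ i, (P.agentBits v i : ℝ) ≤ c * ((m : ℝ) / n * Real.logb 2 n)) ∧
    -- identical unit demand valuations
    (∃ c : ℝ, 0 < c ∧ ∀ n m : ℕ, 1 ≤ n → 2 * n ≤ m →
      CCAtMost (identicalInstances n (IsUnitDemand (m := m)))
        (c * (n + Real.logb 2 (Real.logb 2 m)))) ∧
    (∃ c : ℝ, 0 < c ∧ ∀ n m : ℕ, 2 ≤ n → 2 * n ≤ m →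
      CCAtLeast (identicalInstances n (IsUnitDemand (m := m)))
        (c * (n + Real.logb 2 (Real.logb 2 m)))) ∧
    -- identical binary additive valuations
    (∃ c : ℝ, 0 < c ∧ ∀ n m : ℕ, 2 ≤ n → 2 * n ≤ m →
      CCAtLeast (identicalInstances n (IsBinary (m := m)))
        (c * (n * Real.logb 2 ((m : ℝ) / n)))) ∧
    -- identical 2-valued additive valuations
    (∃ c : ℝ, 0 < c ∧ ∀ n m : ℕ, 1 ≤ n → 2 * n ≤ m → ∀ a b : ℝ, 0 ≤ b → b < a →
      CCAtMost (identicalInstances n (IsTwoValued (m := m) a b)) (c * m)) ∧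
    (∃ c : ℝ, 0 < c ∧ ∀ n m : ℕ, 2 ≤ n → 2 * n ≤ m → ∃ a b : ℝ, 0 ≤ b ∧ b < a ∧
      CCAtLeast (identicalInstances n (IsTwoValued (m := m) a b)) (c * m)) :=
  ⟨unitDemand_upper, binary_upper, twoValued_upper, identical_unitDemand_upper,
    identical_unitDemand_lower, identical_binary_lower, identical_twoValued_upper,
    identical_twoValued_lower⟩
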